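/- **Setting.** Let $V$ be a finite (pseudo)metric space with metric $d$, let $G=(V,E)$ be the complete graph on $V$ with edge lengths $d_{\{u,v\}}=d(u,v)$, let $\mathfrak T$ be a set of terminal pairs in $V$, and write $d(X)=\sum_{e\in X}d_e$ for $X\subseteq E$. A set $X\subseteq E$ is feasible if it connects every terminal pair. The width $w(C)$ of a vertex set $C$ is the largest distance of a terminal pair with both ends in $C$ ($0$ if there is none), $w(X)$ is the sum of the widths of the connected components of $(V,X)$, and $\phi(X)=d(X)+w(X)$. Let $\mathscr A\subseteq E$ be a feasible forest, and let $T_1,\dots,T_p$ be the connected components of $(V,\mathscr A)$, numbered such that $w(T_1)\le\dots\le w(T_p)$; $\xi(v)$ is the index of the component that contains $v$. For $X\subseteq E$ let $X_\circlearrowright$ be the set of edges of $X$ that have both ends in the same component of $\mathscr A$, and $X_\leftrightarrow=X\setminus X_\circlearrowright$. **Moves.** Let $e$ be a (possibly virtual) new edge with distinct ends $u,v$ in one component of $\mathscr A$ (parallel to the edge $\{u,v\}$ of $\mathscr A$ if there is one), and let $P$ be the $u$-$v$-path in $\mathscr A$. Fix one of two conventions, the same for all swaps: a nonempty set $S\subseteq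 P$ is *removable for $e$* (a) if $(\mathscr A\setminus S)\cup\{e\}$ is feasible; or (b) if, for some $f\in P$, $S$ is a block of consecutive edges (in the order along $P$) of $R(e,f)=\{g\in P: (\mathscr A\setminus\{f,g\})\cup\{e\}\text{ is feasible}\}$. * Let $B$ be a set of edges with lengths $\ell$. $\mathscr A$ is *edge/set swap-optimal with respect to $(B,\ell)$* if for each $e\in B$ with both ends in one component of $\mathscr A$ and each $S$ removable for $e$, $\phi(\mathscr A)\le d(\mathscr A\setminus S)+\ell(e)+w((\mathscr A\setminus S)\cup\{e\})$. If $\ell$ is not mentioned, $\ell=d$. * $\mathscr A$ is *path/set swap-optimal with respect to $B\subseteq E$* if for all distinct $u,v$ in one component $T$ of $\mathscr A$, each edge set $X\subseteq B$ of a shortest $u$-$v$-path among all $u$-$v$-paths with edges from $B$ in the graph obtained from $G$ by contracting all components of $\mathscr A$ other than $T$ and deleting all vertices of $T$ but $u,v$, and each $S$ removable for a virtual edge $\{u,v\}$, $\phi(\mathscr A)\le d(\mathscr A\setminus S)+d(X)+w((\mathscr A\setminus S)\cup X)$. * For $c\ge1$, $\mathscr A$ is *$c$-approximate connecting move optimal*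 if no $X\subseteq E$ that is the edge set of a tree with at least one edge in the multigraph obtained from $G$ by contracting the components of $\mathscr A$ (deleting loops, keeping parallel edges) satisfies $c\cdot d(X)\le w(\mathscr A)-w(\mathscr A\cup X)$. **Statement.** Let $c\ge 1$, and let $\bar F$ be a simple path in $G$ that starts and ends in the same component $T_{j^\ast}$ of $\mathscr A$, with $\xi(v)\le j^\ast$ for all $v\in V[\bar F]$ and $\bar F\ne\bar F_\circlearrowright$. Assume that $\mathscr A$ is edge/set and path/set swap-optimal with respect to some edge set $E_0\subseteq E$ with $\bar F_\leftrightarrow\subseteq E_0$ (for instance $E_0=\bar F_\leftrightarrow$ or $E_0=E$), and that $\mathscr A$ is $c$-approximate connecting move optimal. Then there are a set $R$ of edges on the vertex set $V[\bar F_\leftrightarrow]$ and lengths $\ell(e)\ge0$ for $e\in R$ (each edge of $R$ is a new, virtual edge, whose length may differ from the distance of its ends) with $(\bar F_\circlearrowright\cup R)_\circlearrowright=\bar F_\circlearrowright\cup R$ and the following properties, where $F_1',\dots,F_x'$ are the connected components of the graph $(V[\bar F],\bar F_\circlearrowright\cup R)$ (isolated vertices included): 1. $\mathscr A$ is edge/set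 swap-optimal with respect to $(R,\ell)$. 2. Every $F'_i$ lies in a single component $T_j$ of $\mathscr A$; put $\xi(F'_i)=j$. 3. Exactly one of the $F'_i$, say $F'_1$, has $\xi(F'_i)=j^\ast$. 4. $\sum_{e\in R}\ell(e)\le d(\bar F_\leftrightarrow)$ and $\sum_{i=2}^{x}w(T_{\xi(F'_i)})\le c\cdot d(\bar F_\leftrightarrow)$. -/

import Mathlib

open scoped NNReal

namespace SteinerForest

noncomputable section

/-! The instance is metric: `G` is the complete graph on the finite (pseudo)metric space `V`, edges
are unordered pairs, solutions are finite sets of edges, `D` is the set of terminal pairs.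
By the triangle inequality the shortest-path distance in `G` is the metric itself. -/

/-- Length of an edge, also the distance of a terminal pair. -/
def len {V : Type*} [PseudoMetricSpace V] : Sym2 V → ℝ≥0 :=
  Sym2.lift ⟨fun u v => nndist u v, fun u v => nndist_comm u v⟩

/-- `d(F)`. -/
def totalLength {V : Type*} [PseudoMetricSpace V] (F : Finset (Sym2 V)) : ℝ :=
  ∑ e ∈ F, (len e : ℝ)

/-- The spanning graph `(V, F)`. -/
abbrev graph {V : Type*} (F : Finset (Sym2 V)) : SimpleGraph V :=
  SimpleGraph.fromEdgeSet (F : Set (Sym2 V))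

open Classical in
/-- Width of a vertex set `C`: largest distance of a terminal pair with both ends in `C`
(zero if there is none). -/
def width {V : Type*} [PseudoMetricSpace V] (D : Finset (Sym2 V)) (C : Set V) : ℝ :=
  (((D.filter fun q => ∀ x ∈ q, x ∈ C).sup len : ℝ≥0) : ℝ)

open Classical in
/-- The connected components of `(V, F)` that contain a vertex of `W`. -/
def componentsMeeting {V : Type*} (F : Finset (Sym2 V)) (W : Finset V) :
    Finset (graph F).ConnectedComponent :=
  W.image (graph F).connectedComponentMk

/-- `w(F)`: sum of the widths of the connected components (isolated vertices contribute zero). -/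
def totalWidth {V : Type*} [Fintype V] [PseudoMetricSpace V] (D F : Finset (Sym2 V)) : ℝ :=
  ∑ K ∈ componentsMeeting F Finset.univ, width D K.supp

/-- The potential `φ(F) = d(F) + w(F)`. -/
def potential {V : Type*} [Fintype V] [PseudoMetricSpace V] (D F : Finset (Sym2 V)) : ℝ :=
  totalLength F + totalWidth D F

/-- Every terminal pair is connected by `F`. -/
def Feasible {V : Type*} (D F : Finset (Sym2 V)) : Prop :=
  ∀ u v : V, s(u, v) ∈ D → (graph F).Reachable u v

/-- A feasible cycle-free solution in the complete graph. -/
structure IsSteinerForest {V : Type*} (D A : Finset (Sym2 V)) : Prop where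
  not_isDiag : ∀ e ∈ A, ¬ e.IsDiag
  acyclic : (graph A).IsAcyclic
  feasible : Feasible D A

/-- An edge runs within a connected component of `A`. -/
def Inside {V : Type*} (A : Finset (Sym2 V)) (e : Sym2 V) : Prop :=
  ∀ x ∈ e, ∀ y ∈ e, (graph A).Reachable x y

open Classical in
/-- The edges of `F` within components of `A`. -/
def innerEdges {V : Type*} (A F : Finset (Sym2 V)) : Finset (Sym2 V) :=
  F.filter fun e => Inside A e

open Classical in
/-- The edges of `F` between different components of `A`. -/
def crossingEdges {V : Type*} (A F : Finset (Sym2 V)) : Finset (Sym2 V) :=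
  F.filter fun e => ¬ Inside A e

/-! ### Swaps -/

/-- The two conventions for what a swap may remove from the cycle it creates: any set of edges
whose removal leaves a feasible solution, or only a block of consecutive edges of some
`R(e, f)`. -/
inductive RemovalRule
  | arbitrary
  | consecutive

open Classical in
/-- `R(e, f)` for the cycle that `e = {u, v}` closes with the path `P` of `A`: the edge `f`
together with all edges of the cycle that can be dropped along with `f` once `e` is present. -/
def exchangeSet {V : Type*} (D A : Finset (Sym2 V)) {u v : V} (P : (graph A).Walk u v)
    (f : Sym2 V) : Finset (Sym2 V) :=
  P.edges.toFinset.filter fun g => Feasible D (insert s(u, v) (A \ {f, g}))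

open Classical in
/-- `S` may be removed from `A` after adding a new (possibly virtual, possibly parallel) edge
between `u` and `v`: it is a nonempty set of edges of the cycle `{u, v} + P`, where `P` is the
`u`-`v`-path in `A`, that is permitted by the rule. -/
def IsRemovalSet {V : Type*} (κ : RemovalRule) (D A : Finset (Sym2 V)) (u v : V)
    (S : Finset (Sym2 V)) : Prop :=
  S.Nonempty ∧ ∃ P : (graph A).Walk u v, P.IsPath ∧
    match κ with
    | .arbitrary => (∀ g ∈ S, g ∈ P.edges) ∧ Feasible D (insert s(u, v) (A \ S))
    | .consecutive => ∃ f ∈ P.edges, ∃ i j : ℕ,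
        S = (exchangeSet D A P f).filter fun g => i ≤ P.edges.idxOf g ∧ P.edges.idxOf g ≤ j

open Classical in
/-- No edge/set swap that adds an edge `{u, v}` of `F`, taken with length `ℓ {u, v}`, is improving.
The added edge is a new edge: if `A` already has an edge `{u, v}`, the two are parallel. -/
def EdgeSetSwapOptimal {V : Type*} [Fintype V] [PseudoMetricSpace V] (κ : RemovalRule)
    (D A F : Finset (Sym2 V)) (ℓ : Sym2 V → ℝ≥0) : Prop :=
  ∀ u v : V, s(u, v) ∈ F → ∀ S : Finset (Sym2 V), IsRemovalSet κ D A u v S →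
    potential D A ≤
      totalLength (A \ S) + (ℓ s(u, v) : ℝ) + totalWidth D (insert s(u, v) (A \ S))

/-- `L = [(a₀, b₀), …, (aₘ, bₘ)]` is a `u`-`v`-path, with edges `{aᵢ, bᵢ}` from `F`, in the graph
that is obtained by shrinking the components of `A` not containing `u` and `v` to points and
deleting all of the component of `u` and `v` but `u` and `v`: it starts in `u`, ends in `v`, each
`bᵢ` lies in the component of `aᵢ₊₁`, and no component is left twice. -/
def IsContractedPath {V : Type*} (A F : Finset (Sym2 V)) (u v : V) (L : List (V × V)) : Prop :=
  L.head?.map Prod.fst = some u ∧ L.getLast?.map Prod.snd = some v ∧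
    L.IsChain (fun x y => (graph A).Reachable x.2 y.1) ∧
    (L.map fun x => (graph A).connectedComponentMk x.1).Nodup ∧
    ∀ x ∈ L, s(x.1, x.2) ∈ F

/-- Length of a path in the contracted graph. -/
def contractedLength {V : Type*} [PseudoMetricSpace V] (L : List (V × V)) : ℝ :=
  (L.map fun x => dist x.1 x.2).sum

open Classical in
/-- No path/set swap is improving that adds, for distinct `u`, `v` in one component of `A`, a
shortest path of the contracted graph with edges from `F`, and removes a set of edges that may be
removed after adding a virtual edge `{u, v}`. -/
def PathSetSwapOptimal {V : Type*} [Fintype V] [PseudoMetricSpace V] (κ : RemovalRule)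
    (D A F : Finset (Sym2 V)) : Prop :=
  ∀ u v : V, u ≠ v → (graph A).Reachable u v →
    ∀ L : List (V × V), IsContractedPath A F u v L →
      (∀ L', IsContractedPath A F u v L' → contractedLength L ≤ contractedLength L') →
      ∀ S : Finset (Sym2 V), IsRemovalSet κ D A u v S →
        potential D A ≤ totalLength (A \ S) + contractedLength L +
          totalWidth D ((A \ S) ∪ (L.map fun x => s(x.1, x.2)).toFinset)

/-! ### Connecting moves -/

/-- The graph on the components of `A` formed by the edges of `T`. -/
def contractedGraph {V : Type*} (A T : Finset (Sym2 V)) :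
    SimpleGraph (graph A).ConnectedComponent :=
  SimpleGraph.fromEdgeSet (Sym2.map (graph A).connectedComponentMk '' (T : Set (Sym2 V)))

/-- `T` is (the edge set of) a tree with at least one edge in the multigraph obtained from the
complete graph by contracting the components of `A`, deleting loops and keeping parallel edges. -/
structure IsConnectingTree {V : Type*} (A T : Finset (Sym2 V)) : Prop where
  nonempty : T.Nonempty
  no_loop : ∀ e ∈ T, ¬ (Sym2.map (graph A).connectedComponentMk e).IsDiag
  no_parallel : Set.InjOn (Sym2.map (graph A).connectedComponentMk) (T : Set (Sym2 V))
  acyclic : (contractedGraph A T).IsAcyclic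
  connected : ∀ e ∈ T, ∀ f ∈ T, ∀ x ∈ e, ∀ y ∈ f, (contractedGraph A T).Reachable
    ((graph A).connectedComponentMk x) ((graph A).connectedComponentMk y)

open Classical in
/-- There is no `c`-approximate connecting move. -/
def ConnectingMoveOptimal {V : Type*} [Fintype V] [PseudoMetricSpace V]
    (D A : Finset (Sym2 V)) (c : ℝ) : Prop :=
  ∀ T : Finset (Sym2 V), IsConnectingTree A T →
    ¬ (c * totalLength T ≤ totalWidth D A - totalWidth D (A ∪ T))

/-- `ξ(v)`: the number of the component of `A` that contains `v`. -/
def compIndex {V : Type*} {A : Finset (Sym2 V)} {p : ℕ}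
    (num : (graph A).ConnectedComponent ≃ Fin p) (v : V) : Fin p :=
  num ((graph A).connectedComponentMk v)

open Classical in
/-- Sum of `w(A_{j(K)})` over all components `K ≠ K₁` of `(V, B)` that contain a vertex of `W`. -/
def widthSumExcept {V : Type*} [PseudoMetricSpace V] (D : Finset (Sym2 V)) {A : Finset (Sym2 V)}
    {p : ℕ} (num : (graph A).ConnectedComponent ≃ Fin p) (B : Finset (Sym2 V)) (W : Finset V)
    (j : (graph B).ConnectedComponent → Fin p) (K₁ : (graph B).ConnectedComponent) : ℝ :=
  ∑ K ∈ (componentsMeeting B W).erase K₁, width D (num.symm (j K)).supp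

end

end SteinerForest

open SteinerForest

/-! ### Reachability and comparison of sums -/

open SteinerForest

/-! Regard the number of a component as a height: the path starts and ends at its maximal height.
Its crossing edges, in order, are the initial super edges; consecutive ones are joined by inner
edges. Super edges are eliminated until none is left. One that returns to the component in which it
starts becomes a virtual edge of `R`, as long as the walk that it stands for. If no super edge does
so, the walk has a local minimum (`exists_local_min`); the two super edges that meet there are
merged, and the width of the component at the minimum is paid from their budget.

Swap-optimality: merging only at local minima keeps all inner components of a super edge strictly
below both of its ends. So when a super edge closes, its walk avoids the component of its ends in
between and contains a contracted path. A shortest contracted path is no longer than the walk and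
connects at least what the virtual edge connects, so the bound for path/set swaps gives the bound
for the virtual edge (`IsSuperEdge.potential_le`).

Budget: a crossing edge starts with `c` times its length. The invariant is that the cost of every
sublist of the super edges is at least its dominated width, the total width of the components of `A`
that it connects to higher ones. Dominated width is at most the total width saved, so the invariant
holds initially because there are no connecting moves, once this is extended from trees to all edge
sets (`ConnectingMoveOptimal.dominatedWidth_le`). It survives merging (`dominatedWidth_merge_le`),
and it makes every remaining cost nonnegative, so the payments never exceed the initial budget.

In the end each vertex of the path is connected by inner edges and `R` to `s` or to a minimum that
has been paid. Those minima are strictly below the top, so the component of `s` is the only one at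
the top, and every other component contains a paid vertex. -/

theorem SimpleGraph.Reachable.of_forall_adj {V : Type*} {G H : SimpleGraph V}
    (h : ∀ a b, G.Adj a b → H.Reachable a b) {u v : V} (huv : G.Reachable u v) :
    H.Reachable u v := by
  obtain ⟨p⟩ := huv
  induction p with
  | nil => exact SimpleGraph.Reachable.refl _
  | cons hadj _ ih => exact (h _ _ hadj).trans ih

/-- A walk of `H` from `u` cannot leave the `G`-component of `u`, as each `H`-edge that starts there
is realised in `G`. Thus edges that change elsewhere do not matter. -/
theorem SimpleGraph.reachable_of_closed {V : Type*} {G H : SimpleGraph V} {u v : V}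
    (huv : H.Reachable u v) (h : ∀ a b, G.Reachable u a → H.Adj a b → G.Reachable a b) :
    G.Reachable u v := by
  obtain ⟨p⟩ := huv
  induction p with
  | nil => exact SimpleGraph.Reachable.refl _
  | cons hadj _ ih =>
    have h1 := h _ _ (SimpleGraph.Reachable.refl _) hadj
    exact h1.trans (ih fun a b hua hab => h a b (h1.trans hua) hab)

namespace SteinerForest

theorem sum_comp_le_sum {α β : Type*} {s : Finset α} {t : Finset β} {g : α → β} {f : β → ℝ}
    (hst : ∀ a ∈ s, g a ∈ t) (hg : Function.Injective g) (hf : ∀ b, 0 ≤ f b) :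
    ∑ a ∈ s, f (g a) ≤ ∑ b ∈ t, f b := by
  classical
  rw [← Finset.sum_image (f := f) fun _ _ _ _ h => hg h]
  refine Finset.sum_le_sum_of_subset_of_nonneg (fun b hb => ?_) fun b _ _ => hf b
  obtain ⟨a, ha, rfl⟩ := Finset.mem_image.1 hb
  exact hst a ha

/-! ### Widths of components -/

section Width

variable {V : Type*} [PseudoMetricSpace V]

theorem width_nonneg (D : Finset (Sym2 V)) (C : Set V) : 0 ≤ width D C := NNReal.coe_nonneg _

theorem len_le_width {D : Finset (Sym2 V)} {C : Set V} {q : Sym2 V} (hq : q ∈ D)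
    (hC : ∀ x ∈ q, x ∈ C) : (len q : ℝ) ≤ width D C := by
  classical
  unfold width
  exact_mod_cast Finset.le_sup (f := len) (Finset.mem_filter.2 ⟨hq, hC⟩)

/-- The width is zero or attained by a terminal pair. -/
theorem width_eq_zero_or (D : Finset (Sym2 V)) (C : Set V) :
    width D C = 0 ∨ ∃ a b, s(a, b) ∈ D ∧ a ∈ C ∧ b ∈ C ∧ width D C = len s(a, b) := by
  classical
  unfold width
  by_cases hS : (D.filter fun q => ∀ x ∈ q, x ∈ C).Nonempty
  · right
    obtain ⟨q, hq, hqe⟩ := Finset.exists_mem_eq_sup _ hS (len (V := V))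
    induction q with
    | h a b =>
      rw [Finset.mem_filter] at hq
      exact ⟨a, b, hq.1, hq.2 a (by simp), hq.2 b (by simp), congrArg _ (by convert hqe)⟩
  · left
    rw [Finset.not_nonempty_iff_eq_empty] at hS
    rw [NNReal.coe_eq_zero, ← bot_eq_zero, ← Finset.sup_empty (f := (len (V := V)))]
    congr 1

theorem mem_componentsMeeting_univ {V : Type*} [Fintype V] {F : Finset (Sym2 V)}
    (K : (graph F).ConnectedComponent) : K ∈ componentsMeeting F Finset.univ := by
  classical
  induction K using SimpleGraph.ConnectedComponent.ind with
  | h v => exact Finset.mem_image_of_mem _ (Finset.mem_univ v)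

theorem mem_supp_mk {V : Type*} {F : Finset (Sym2 V)} {u v : V} :
    u ∈ ((graph F).connectedComponentMk v).supp ↔ (graph F).Reachable u v :=
  SimpleGraph.ConnectedComponent.eq

/-- The width of a component is at most that of some component of a given feasible solution that
it meets. -/
theorem exists_width_le_width {D F F' : Finset (Sym2 V)} (hF : Feasible D F)
    (K' : (graph F').ConnectedComponent) : ∃ a ∈ K'.supp, (width D K'.supp ≤
      width D ((graph F).connectedComponentMk a).supp) := by
  rcases width_eq_zero_or D K'.supp with h0 | ⟨a, b, hab, ha, hb, hw⟩
  · obtain ⟨v, hv⟩ := K'.nonempty_supp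
    exact ⟨v, hv, h0 ▸ width_nonneg _ _⟩
  · refine ⟨a, ha, ?_⟩
    rw [hw]
    refine len_le_width hab fun x hx => ?_
    rcases Sym2.mem_iff.1 hx with rfl | rfl
    · exact mem_supp_mk.2 (SimpleGraph.Reachable.refl _)
    · exact mem_supp_mk.2 (hF _ _ hab).symm

/-- Coarsening the components of a feasible solution does not increase the total width. -/
theorem totalWidth_anti [Fintype V] {D F F' : Finset (Sym2 V)} (hF : Feasible D F)
    (h : ∀ u v, (graph F).Reachable u v → (graph F').Reachable u v) :
    totalWidth D F' ≤ totalWidth D F := by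
  -- Each component of `F'` is charged to a component of `F` that meets it and is at least as wide.
  -- Components of `F` lie inside those of `F'`, so the charging is injective.
  choose g hg hg' using exists_width_le_width (F' := F') hF
  unfold totalWidth
  refine (Finset.sum_le_sum fun K _ => hg' K).trans ?_
  have hinj : Function.Injective fun K => (graph F).connectedComponentMk (g K) := by
    intro K₁ K₂ h12
    have h3 : (graph F').Reachable (g K₁) (g K₂) := h _ _ (SimpleGraph.ConnectedComponent.eq.1 h12)
    have h1 : (graph F').connectedComponentMk (g K₁) = K₁ := hg K₁
    have h2 : (graph F').connectedComponentMk (g K₂) = K₂ := hg K₂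
    rw [← h1, ← h2]
    exact SimpleGraph.ConnectedComponent.eq.2 h3
  exact sum_comp_le_sum (g := fun K => (graph F).connectedComponentMk (g K))
    (f := fun K => width D K.supp) (fun K _ => mem_componentsMeeting_univ _) hinj
    (fun _ => width_nonneg _ _)

end Width

end SteinerForest

/-! ### Removal sets leave feasible solutions -/

namespace SteinerForest

variable {V : Type*}

theorem graph_mono {F F' : Finset (Sym2 V)} (h : F ⊆ F') : graph F ≤ graph F' :=
  SimpleGraph.fromEdgeSet_mono (Finset.coe_subset.2 h)

theorem Feasible.mono {D F F' : Finset (Sym2 V)} (hF : Feasible D F) (h : F ⊆ F') :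
    Feasible D F' := fun u v huv => (hF u v huv).mono (graph_mono h)

/-- Exchanging an edge of a path of a forest for an edge between the ends of the path preserves
acyclicity. -/
theorem isAcyclic_exchange [DecidableEq (Sym2 V)] {A : Finset (Sym2 V)} (hA : (graph A).IsAcyclic)
    {u v : V}
    {P : (graph A).Walk u v} (hP : P.IsPath) {f : Sym2 V} (hf : f ∈ P.edges) :
    (graph (insert s(u, v) (A \ {f}))).IsAcyclic := by
  have hle : graph (A \ {f}) ≤ graph A := graph_mono Finset.sdiff_subset
  -- A path that avoids `f` would be a second `u`-`v`-path in the forest, besides `P`.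
  have hnot : ¬ (graph (A \ {f})).Reachable u v := by
    intro h
    obtain ⟨Q, hQ⟩ := h.exists_isPath
    have heq : (⟨P, hP⟩ : (graph A).Path u v) = ⟨Q.mapLe hle, hQ.mapLe hle⟩ :=
      (hA.subsingleton_path u v).elim _ _
    have heq' : P = Q.mapLe hle := congrArg Subtype.val heq
    rw [heq', SimpleGraph.Walk.edges_mapLe_eq_edges] at hf
    have := Q.edges_subset_edgeSet hf
    simp [graph] at this
    tauto
  refine ((hA.anti hle).sup_edge_of_not_reachable hnot).anti ?_
  intro a b hab
  simp only [graph, SimpleGraph.fromEdgeSet_adj, Finset.coe_insert, Set.mem_insert_iff,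
    SimpleGraph.sup_adj, SimpleGraph.edge_adj, Sym2.eq_iff] at hab ⊢
  tauto

/-- What remains after removing a removal set and adding the new edge is feasible. -/
theorem IsRemovalSet.feasible [DecidableEq (Sym2 V)] {κ : RemovalRule} {D A : Finset (Sym2 V)}
    (hA : IsSteinerForest D A)
    {u v : V} {S : Finset (Sym2 V)} (hS : IsRemovalSet κ D A u v S) :
    Feasible D (insert s(u, v) (A \ S)) := by
  classical
  obtain ⟨hne, P, hP, h⟩ := hS
  cases κ with
  | arbitrary => convert h.2
  | consecutive =>
    obtain ⟨f, hf, i, j, hS⟩ := h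
    have hfeas : ∀ g ∈ S, Feasible D (insert s(u, v) (A \ {f, g})) := by
      intro g hg
      have := (Finset.mem_filter.1 (Finset.mem_filter.1 (hS ▸ hg)).1).2
      convert this
    -- Each single `g ∈ S` can be dropped along with `f`. The graphs that remain are subgraphs of
    -- one forest, where the path between two terminals is unique; hence, the added edge aside, this
    -- path avoids all of `S` at once.
    have hac := isAcyclic_exchange hA.acyclic hP hf
    have hle : ∀ g, graph (insert s(u, v) (A \ {f, g})) ≤ graph (insert s(u, v) (A \ {f})) := by
      intro g
      apply graph_mono
      intro e
      simp only [Finset.mem_insert, Finset.mem_sdiff, Finset.mem_singleton]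
      tauto
    obtain ⟨g₀, hg₀⟩ := hne
    intro x y hxy
    obtain ⟨Q, hQ⟩ := (hfeas g₀ hg₀ x y hxy).exists_isPath
    have hedges : ∀ g ∈ S, ∀ e ∈ Q.edges, e ∈ (graph (insert s(u, v) (A \ {f, g}))).edgeSet := by
      intro g hg e he
      obtain ⟨Q', hQ'⟩ := (hfeas g hg x y hxy).exists_isPath
      have heq : (⟨Q.mapLe (hle g₀), hQ.mapLe _⟩ : (graph (insert s(u, v) (A \ {f}))).Path x y) =
        ⟨Q'.mapLe (hle g), hQ'.mapLe _⟩ := (hac.subsingleton_path x y).elim _ _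
      have heq' := congrArg SimpleGraph.Walk.edges (congrArg Subtype.val heq)
      simp only [SimpleGraph.Walk.edges_mapLe_eq_edges] at heq'
      exact Q'.edges_subset_edgeSet (heq' ▸ he)
    refine ⟨Q.transfer _ fun e he => ?_⟩
    have h0 := hedges g₀ hg₀ e he
    simp only [graph, SimpleGraph.edgeSet_fromEdgeSet, Set.mem_sdiff, Finset.mem_coe,
      Finset.mem_insert, Finset.mem_sdiff, Finset.mem_singleton] at h0 ⊢
    refine ⟨?_, h0.2⟩
    by_cases hed : e = s(u, v)
    · exact Or.inl hed
    · refine Or.inr ⟨by tauto, fun heS => ?_⟩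
      have h1 := hedges e heS e he
      simp only [graph, SimpleGraph.edgeSet_fromEdgeSet, Set.mem_sdiff, Finset.mem_coe,
        Finset.mem_insert, Finset.mem_sdiff, Finset.mem_singleton] at h1
      tauto

/-- A removal set only contains edges of the component of the new edge. -/
theorem IsRemovalSet.reachable {κ : RemovalRule} {D A : Finset (Sym2 V)}
    {u v : V} {S : Finset (Sym2 V)} (hS : IsRemovalSet κ D A u v S) {e : Sym2 V} (he : e ∈ S)
    {x : V} (hx : x ∈ e) : (graph A).Reachable u x := by
  classical
  obtain ⟨-, P, -, h⟩ := hS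
  have heP : e ∈ P.edges := by
    cases κ with
    | arbitrary => exact h.1 e he
    | consecutive =>
      obtain ⟨f, hf, i, j, rfl⟩ := h
      have := (Finset.mem_filter.1 (Finset.mem_filter.1 he).1).1
      simpa using this
  induction e with
  | h a b =>
    rcases Sym2.mem_iff.1 hx with rfl | rfl
    · exact ⟨P.takeUntil _ (P.fst_mem_support_of_mem_edges heP)⟩
    · exact ⟨P.takeUntil _ (P.snd_mem_support_of_mem_edges heP)⟩

end SteinerForest

/-! ### Contracted walks and swaps with virtual edges -/

namespace SteinerForest

variable {V : Type*}

/-- `L` describes a walk from `a` to `b` that uses the edges of `L` and otherwise moves within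
components of `A`. -/
structure IsContractedWalk (A : Finset (Sym2 V)) (a b : V) (L : List (V × V)) : Prop where
  head : L.head?.map Prod.fst = some a
  last : L.getLast?.map Prod.snd = some b
  chain : L.IsChain (fun x y => (graph A).Reachable x.2 y.1)

theorem IsContractedWalk.ne_nil {A : Finset (Sym2 V)} {a b : V} {L : List (V × V)}
    (h : IsContractedWalk A a b L) : L ≠ [] := by
  rintro rfl
  simpa using h.head

theorem IsContractedWalk.exists_cons {A : Finset (Sym2 V)} {a b : V} {L : List (V × V)}
    (h : IsContractedWalk A a b L) : ∃ x l, L = (a, x) :: l := by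
  obtain ⟨h1, -, -⟩ := h
  cases L with
  | nil => simp at h1
  | cons x l =>
    obtain ⟨x1, x2⟩ := x
    simp only [List.head?_cons, Option.map_some, Option.some.injEq] at h1
    exact ⟨x2, l, by rw [h1]⟩

theorem IsContractedWalk.exists_concat {A : Finset (Sym2 V)} {a b : V} {L : List (V × V)}
    (h : IsContractedWalk A a b L) : ∃ x l, L = l ++ [(x, b)] := by
  obtain ⟨-, h1, -⟩ := h
  rcases L.eq_nil_or_concat with rfl | ⟨l, x, rfl⟩
  · simp at h1
  · obtain ⟨x1, x2⟩ := x
    simp only [List.concat_eq_append, List.getLast?_concat, Option.map_some,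
      Option.some.injEq] at h1
    exact ⟨x1, l, by rw [List.concat_eq_append, h1]⟩

theorem IsContractedWalk.append {A : Finset (Sym2 V)} {a b a' b' : V} {L L' : List (V × V)}
    (h : IsContractedWalk A a b L) (h' : IsContractedWalk A a' b' L')
    (hb : (graph A).Reachable b a') : IsContractedWalk A a b' (L ++ L') := by
  refine ⟨?_, ?_, List.isChain_append.2 ⟨h.chain, h'.chain, ?_⟩⟩
  · obtain ⟨x, l, rfl⟩ := h.exists_cons
    simp
  · obtain ⟨x, l, rfl⟩ := h'.exists_concat
    rw [← List.append_assoc]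
    simp
  · obtain ⟨x, l, rfl⟩ := h.exists_concat
    obtain ⟨x', l', rfl⟩ := h'.exists_cons
    simpa using hb

theorem IsContractedWalk.reverse {A : Finset (Sym2 V)} {a b : V} {L : List (V × V)}
    (h : IsContractedWalk A a b L) : IsContractedWalk A b a (L.reverse.map Prod.swap) := by
  refine ⟨?_, ?_, ?_⟩
  · obtain ⟨x, l, rfl⟩ := h.exists_concat
    simp
  · obtain ⟨x, l, rfl⟩ := h.exists_cons
    simp
  · rw [List.isChain_map, List.isChain_reverse]
    exact h.chain.imp fun x y hxy => hxy.symm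

/-- Shortcutting a contracted walk such that no component is left twice. -/
theorem exists_sublist_nodup (A : Finset (Sym2 V)) (x : V × V) (L : List (V × V))
    (hL : (x :: L).IsChain (fun x y => (graph A).Reachable x.2 y.1)) :
    ∃ y L', (y :: L').Sublist (x :: L) ∧
      (y :: L').IsChain (fun x y => (graph A).Reachable x.2 y.1) ∧
      ((y :: L').map fun x => (graph A).connectedComponentMk x.1).Nodup ∧
      (y :: L').getLast? = (x :: L).getLast? ∧ (graph A).Reachable x.1 y.1 := by
  induction L generalizing x with
  | nil => exact ⟨x, [], List.Sublist.refl _, hL, by simp, rfl, SimpleGraph.Reachable.refl _⟩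
  | cons z L ih =>
    obtain ⟨hxz, hzL⟩ := List.isChain_cons_cons.1 hL
    obtain ⟨y, L', hsub, hch, hnd, hlast, hreach⟩ := ih z hzL
    -- If the shortcut rest visits the component of `x` again, the walk restarts at that later
    -- element; otherwise `x` is kept.
    by_cases hmem : (graph A).connectedComponentMk x.1 ∈
        (y :: L').map fun x => (graph A).connectedComponentMk x.1
    · obtain ⟨z', hz', hzx⟩ := List.mem_map.1 hmem
      obtain ⟨p, q, hpq⟩ := List.append_of_mem hz'
      rw [hpq] at hsub hch hnd hlast
      refine ⟨z', q, ((List.sublist_append_right p _).trans hsub).cons _,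
        (List.isChain_append.1 hch).2.1, ?_, ?_, SimpleGraph.ConnectedComponent.eq.1 hzx.symm⟩
      · rw [List.map_append] at hnd
        exact hnd.of_append_right
      · rw [List.getLast?_cons_cons, ← hlast, List.getLast?_append_of_ne_nil _ (by simp)]
    · refine ⟨x, y :: L', hsub.cons_cons _, List.isChain_cons_cons.2 ⟨hxz.trans hreach, hch⟩, ?_, ?_,
        SimpleGraph.Reachable.refl _⟩
      · rw [List.map_cons, List.nodup_cons]
        exact ⟨hmem, hnd⟩
      · rw [List.getLast?_cons_cons, hlast, List.getLast?_cons_cons]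

variable [PseudoMetricSpace V]

theorem contractedLength_nonneg (L : List (V × V)) : 0 ≤ contractedLength L :=
  List.sum_nonneg (by simp only [List.mem_map]; rintro _ ⟨x, -, rfl⟩; exact dist_nonneg)

theorem contractedLength_append (L L' : List (V × V)) :
    contractedLength (L ++ L') = contractedLength L + contractedLength L' := by
  simp [contractedLength]

theorem contractedLength_le_of_sublist {L L' : List (V × V)} (h : L.Sublist L') :
    contractedLength L ≤ contractedLength L' :=
  (h.map _).sum_le_sum (by simp only [List.mem_map]; rintro _ ⟨x, -, rfl⟩; exact dist_nonneg)

theorem contractedLength_reverse (L : List (V × V)) :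
    contractedLength (L.reverse.map Prod.swap) = contractedLength L := by
  simp [contractedLength, Function.comp_def, dist_comm]

/-- A contracted walk whose interior avoids the component of its start contains a contracted
path. -/
theorem IsContractedWalk.exists_isContractedPath {A E : Finset (Sym2 V)} {u v : V}
    {L : List (V × V)} (hL : IsContractedWalk A u v L) (hE : ∀ x ∈ L, s(x.1, x.2) ∈ E)
    (htail : ∀ x ∈ L.tail, ¬ (graph A).Reachable u x.1) :
    ∃ L', IsContractedPath A E u v L' ∧ contractedLength L' ≤ contractedLength L := by
  obtain ⟨w, l, rfl⟩ := hL.exists_cons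
  -- Only the part after the first edge is shortcut, so that the path still starts in `u` itself;
  -- `htail` keeps the rest out of the component of `u`.
  rcases l with - | ⟨z, l⟩
  · exact ⟨_, ⟨hL.head, hL.last, hL.chain, by simp, hE⟩, le_rfl⟩
  obtain ⟨hxz, hzL⟩ := List.isChain_cons_cons.1 hL.chain
  obtain ⟨y, L', hsub, hch, hnd, hlast, hreach⟩ := exists_sublist_nodup A z l hzL
  have hsub' : ((u, w) :: y :: L').Sublist ((u, w) :: z :: l) := hsub.cons_cons _
  refine ⟨(u, w) :: y :: L', ⟨rfl, ?_, List.isChain_cons_cons.2 ⟨hxz.trans hreach, hch⟩, ?_,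
    fun x hx => hE x (hsub'.subset hx)⟩, contractedLength_le_of_sublist hsub'⟩
  · rw [List.getLast?_cons_cons, hlast, ← List.getLast?_cons_cons (a := (u, w))]
    exact hL.last
  · rw [List.map_cons, List.nodup_cons]
    refine ⟨fun hmem => ?_, hnd⟩
    obtain ⟨x, hx, hxu⟩ := List.mem_map.1 hmem
    exact htail x (hsub.subset hx) (SimpleGraph.ConnectedComponent.eq.1 hxu.symm)

/-- The elements of a contracted path leave distinct components, so no element repeats and there are
finitely many such paths. -/
theorem exists_shortest_isContractedPath [Finite V] {A E : Finset (Sym2 V)} {u v : V}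
    {L : List (V × V)} (hL : IsContractedPath A E u v L) :
    ∃ L', IsContractedPath A E u v L' ∧ contractedLength L' ≤ contractedLength L ∧
      ∀ L'', IsContractedPath A E u v L'' → contractedLength L' ≤ contractedLength L'' := by
  classical
  have := Fintype.ofFinite V
  have hfin : {L : List (V × V) | IsContractedPath A E u v L}.Finite := by
    refine (List.finite_length_le (V × V) (Fintype.card (V × V))).subset fun L hL => ?_
    exact (List.Nodup.of_map _ hL.2.2.2.1).length_le_card
  obtain ⟨L', hL', hmin⟩ := Set.exists_min_image _ contractedLength hfin ⟨L, hL⟩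
  exact ⟨L', hL', hmin L hL, hmin⟩

/-- `hcomp` exempts the component in which the path starts: a swap may tear it apart, while the
components passed in between must stay intact. -/
theorem IsContractedPath.reachable {V : Type*} {A E F : Finset (Sym2 V)} {u v : V} {L : List (V × V)}
    (hL : IsContractedPath A E u v L)
    (hedge : ∀ x ∈ L, (graph F).Reachable x.1 x.2)
    (hcomp : ∀ x ∈ L.tail, ∀ y, (graph A).Reachable y x.1 → (graph F).Reachable y x.1) :
    (graph F).Reachable u v := by
  obtain ⟨h1, h2, h3, -, -⟩ := hL
  induction L generalizing u with
  | nil => simp at h1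
  | cons x l ih =>
    simp only [List.head?_cons, Option.map_some, Option.some.injEq] at h1
    subst h1
    have hx := hedge x (by simp)
    rcases l with - | ⟨y, l⟩
    · simp only [List.getLast?_singleton, Option.map_some, Option.some.injEq] at h2
      exact h2 ▸ hx
    · obtain ⟨hxy, hch⟩ := List.isChain_cons_cons.1 h3
      refine (hx.trans (hcomp y (by simp) _ hxy)).trans (ih
        (fun z hz => hedge z (List.mem_cons_of_mem _ hz))
        (fun z hz => hcomp z (by simp at hz ⊢; exact Or.inr hz)) rfl ?_ hch)
      rwa [List.getLast?_cons_cons] at h2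

/-- Path/set swap-optimality bounds swaps with a virtual edge that is at least as long as some
contracted walk between its ends. -/
theorem PathSetSwapOptimal.potential_le [Fintype V] [DecidableEq (Sym2 V)] {κ : RemovalRule}
    {D A E : Finset (Sym2 V)}
    (hA : IsSteinerForest D A) (hpath : PathSetSwapOptimal κ D A E) {u v : V} (huv : u ≠ v)
    (hreach : (graph A).Reachable u v) {L : List (V × V)} (hL : IsContractedWalk A u v L)
    (hE : ∀ x ∈ L, s(x.1, x.2) ∈ E) (htail : ∀ x ∈ L.tail, ¬ (graph A).Reachable u x.1)
    {S : Finset (Sym2 V)} (hS : IsRemovalSet κ D A u v S) :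
    potential D A ≤
      totalLength (A \ S) + contractedLength L + totalWidth D (insert s(u, v) (A \ S)) := by
  obtain ⟨L₁, hL₁, hle₁⟩ := hL.exists_isContractedPath hE htail
  obtain ⟨L', hL', hle, hmin⟩ := exists_shortest_isContractedPath hL₁
  have hswap := hpath u v huv hreach L' hL' hmin S hS
  classical
  -- The added path connects `u` and `v`, so the result is at least as coarse as with the virtual
  -- edge, and the total width can only drop.
  have hw : totalWidth D ((A \ S) ∪ (L'.map fun x => s(x.1, x.2)).toFinset) ≤
      totalWidth D (insert s(u, v) (A \ S)) := by
    refine totalWidth_anti (hS.feasible hA) fun a b hab => hab.of_forall_adj fun a b hab => ?_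
    have hmono : graph (A \ S) ≤ graph ((A \ S) ∪ (L'.map fun x => s(x.1, x.2)).toFinset) :=
      graph_mono Finset.subset_union_left
    have huv' : (graph ((A \ S) ∪ (L'.map fun x => s(x.1, x.2)).toFinset)).Reachable u v := by
      refine hL'.reachable (fun x hx => ?_) fun x hx y hy => ?_
      · by_cases hxx : x.1 = x.2
        · rw [hxx]
        · refine SimpleGraph.Adj.reachable ?_
          simp only [graph, SimpleGraph.fromEdgeSet_adj, Finset.mem_coe, Finset.mem_union,
            List.mem_toFinset, List.mem_map]
          exact ⟨Or.inr ⟨x, hx, rfl⟩, hxx⟩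
      -- A removal set stays within the component of `u`, so it does not touch the components passed
      -- in between.
      · have hux : ¬ (graph A).Reachable u x.1 := by
          obtain ⟨h1, -, -, h4, -⟩ := hL'
          cases L' with
          | nil => simp at hx
          | cons z l =>
            simp only [List.head?_cons, Option.map_some, Option.some.injEq] at h1
            subst h1
            rw [List.map_cons, List.nodup_cons] at h4
            exact fun h => h4.1 (List.mem_map.2 ⟨x, hx, SimpleGraph.ConnectedComponent.eq.2 h.symm⟩)
        refine SimpleGraph.Reachable.mono hmono
          (SimpleGraph.reachable_of_closed hy fun c d hc hcd => SimpleGraph.Adj.reachable ?_)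
        simp only [graph, SimpleGraph.fromEdgeSet_adj, Finset.mem_coe, Finset.mem_sdiff] at hcd ⊢
        refine ⟨⟨hcd.1, fun hcS => hux ?_⟩, hcd.2⟩
        exact ((hS.reachable hcS (Sym2.mem_mk_left c d)).trans
          (hc.mono (graph_mono Finset.sdiff_subset)).symm).trans hy
    simp only [graph, SimpleGraph.fromEdgeSet_adj, Finset.coe_insert, Set.mem_insert_iff,
      Sym2.eq_iff] at hab
    rcases hab with ⟨(⟨rfl, rfl⟩ | ⟨rfl, rfl⟩) | hab, hne⟩
    · exact huv'
    · exact huv'.symm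
    · refine SimpleGraph.Adj.reachable (hmono ?_)
      exact (SimpleGraph.fromEdgeSet_adj _).2 ⟨hab, hne⟩
  calc potential D A ≤ totalLength (A \ S) + contractedLength L' +
          totalWidth D ((A \ S) ∪ (L'.map fun x => s(x.1, x.2)).toFinset) := by convert hswap
    _ ≤ _ := by linarith

end SteinerForest

/-! ### Dominated width -/

namespace SteinerForest

section Dominated

variable {V : Type*} {A : Finset (Sym2 V)} {p : ℕ}

theorem compIndex_eq_iff {num : (graph A).ConnectedComponent ≃ Fin p} {u v : V} :
    compIndex num u = compIndex num v ↔ (graph A).Reachable u v := by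
  unfold compIndex
  rw [num.apply_eq_iff_eq, SimpleGraph.ConnectedComponent.eq]

/-- The components of `A` that `G` connects to a component with a larger number. -/
noncomputable def dominated (num : (graph A).ConnectedComponent ≃ Fin p) (G : SimpleGraph V) :
    Finset (Fin p) :=
  open Classical in
  Finset.univ.filter fun i => ∃ u v, compIndex num u = i ∧ i < compIndex num v ∧ G.Reachable u v

theorem mem_dominated {num : (graph A).ConnectedComponent ≃ Fin p} {G : SimpleGraph V}
    {i : Fin p} : i ∈ dominated num G ↔
      ∃ u v, compIndex num u = i ∧ i < compIndex num v ∧ G.Reachable u v := by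
  classical
  unfold dominated
  rw [Finset.mem_filter]
  exact and_iff_right (Finset.mem_univ i)

variable [PseudoMetricSpace V]

/-- The total width of the components of `A` that `G` connects to one with a larger number. -/
noncomputable def dominatedWidth (D : Finset (Sym2 V))
    (num : (graph A).ConnectedComponent ≃ Fin p) (G : SimpleGraph V) : ℝ :=
  ∑ i ∈ dominated num G, width D (num.symm i).supp

theorem dominatedWidth_nonneg (D : Finset (Sym2 V))
    (num : (graph A).ConnectedComponent ≃ Fin p) (G : SimpleGraph V) :
    0 ≤ dominatedWidth D num G := Finset.sum_nonneg fun _ _ => width_nonneg _ _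

theorem dominatedWidth_mono (D : Finset (Sym2 V))
    (num : (graph A).ConnectedComponent ≃ Fin p) {G G' : SimpleGraph V}
    (h : ∀ u v, G.Reachable u v → G'.Reachable u v) :
    dominatedWidth D num G ≤ dominatedWidth D num G' := by
  refine Finset.sum_le_sum_of_subset_of_nonneg (fun i hi => ?_) fun _ _ _ => width_nonneg _ _
  obtain ⟨u, v, hu, hv, huv⟩ := mem_dominated.1 hi
  exact mem_dominated.2 ⟨u, v, hu, hv, h _ _ huv⟩

theorem width_le_dominatedWidth (D : Finset (Sym2 V))
    (num : (graph A).ConnectedComponent ≃ Fin p) {G : SimpleGraph V} {m x : V}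
    (h : G.Reachable m x) (hlt : compIndex num m < compIndex num x) :
    width D (num.symm (compIndex num m)).supp ≤ dominatedWidth D num G :=
  Finset.single_le_sum (f := fun i => width D (num.symm i).supp) (fun _ _ => width_nonneg _ _)
    (mem_dominated.2 ⟨m, x, rfl, hlt, h⟩)

theorem exists_leader {V : Type*} [Finite V] {A : Finset (Sym2 V)} {p : ℕ}
    (num : (graph A).ConnectedComponent ≃ Fin p) (G : SimpleGraph V)
    (m : V) : ∃ v, G.Reachable m v ∧ ∀ u, G.Reachable m u → compIndex num u ≤ compIndex num v := by
  obtain ⟨v, hv, h⟩ := Set.exists_max_image {v | G.Reachable m v} (compIndex num)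
    (Set.toFinite _) ⟨m, SimpleGraph.Reachable.refl m⟩
  exact ⟨v, hv, h⟩

/-- Connecting a further component increases the dominated width by at least its width. -/
theorem dominatedWidth_add_le [Finite V] {D : Finset (Sym2 V)}
    {num : (graph A).ConnectedComponent ≃ Fin p}
    (hnum : ∀ i j : Fin p, i ≤ j → width D (num.symm i).supp ≤ width D (num.symm j).supp)
    {G₁ G₂ : SimpleGraph V} (h₁ : ∀ u v, (graph A).Reachable u v → G₁.Reachable u v)
    (h₂ : ∀ u v, G₁.Reachable u v → G₂.Reachable u v) {m x : V} (hn : ¬ G₁.Reachable m x)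
    (hmx : G₂.Reachable m x) (hle : compIndex num m ≤ compIndex num x) :
    dominatedWidth D num G₁ + width D (num.symm (compIndex num m)).supp ≤
      dominatedWidth D num G₂ := by
  -- The leaders `a` and `b` of the two `G₁`-components that get joined are not dominated in `G₁`.
  -- The lower one becomes dominated in `G₂`, and by `hle` its number is at least that of `m` in
  -- both cases.
  obtain ⟨a, hma, ha⟩ := exists_leader num G₁ m
  obtain ⟨b, hxb, hb⟩ := exists_leader num G₁ x
  have hab : compIndex num a ≠ compIndex num b := fun h =>
    hn ((hma.trans (h₁ _ _ (compIndex_eq_iff.1 h))).trans hxb.symm)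
  have hab₂ : G₂.Reachable a b := ((h₂ _ _ hma).symm.trans hmx).trans (h₂ _ _ hxb)
  have key : ∀ y z, G₁.Reachable y z → (∀ u, G₁.Reachable y u → compIndex num u ≤ compIndex num z) →
      compIndex num z ∉ dominated num G₁ := by
    intro y z hyz hz hmem
    obtain ⟨u, v, hu, hv, huv⟩ := mem_dominated.1 hmem
    exact absurd hv (not_lt.2 (hz _ ((hyz.trans (h₁ _ _ (compIndex_eq_iff.1 hu.symm))).trans huv)))
  obtain ⟨i, hi₁, hi₂, hi⟩ : ∃ i, i ∉ dominated num G₁ ∧ i ∈ dominated num G₂ ∧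
      compIndex num m ≤ i := by
    rcases lt_or_gt_of_ne hab with h | h
    · exact ⟨_, key m a hma ha, mem_dominated.2 ⟨a, b, rfl, h, hab₂⟩,
        ha m (SimpleGraph.Reachable.refl m)⟩
    · exact ⟨_, key x b hxb hb, mem_dominated.2 ⟨b, a, rfl, h, hab₂.symm⟩,
        hle.trans (hb x (SimpleGraph.Reachable.refl x))⟩
  calc _ ≤ dominatedWidth D num G₁ + width D (num.symm i).supp := by
        gcongr; exact hnum _ _ hi
    _ = ∑ j ∈ insert i (dominated num G₁), width D (num.symm j).supp := by
        rw [Finset.sum_insert hi₁, add_comm]; rfl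
    _ ≤ _ := by
        refine Finset.sum_le_sum_of_subset_of_nonneg (fun j hj => ?_) fun _ _ _ => width_nonneg _ _
        rcases Finset.mem_insert.1 hj with rfl | hj
        · exact hi₂
        · obtain ⟨u, v, hu, hv, huv⟩ := mem_dominated.1 hj
          exact mem_dominated.2 ⟨u, v, hu, hv, h₂ _ _ huv⟩

/-- The dominated width is at most the decrease of the total width. -/
theorem dominatedWidth_le_sub [Fintype V] {D F : Finset (Sym2 V)} (hA : Feasible D A)
    {num : (graph A).ConnectedComponent ≃ Fin p}
    (hnum : ∀ i j : Fin p, i ≤ j → width D (num.symm i).supp ≤ width D (num.symm j).supp)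
    (hAF : A ⊆ F) :
    dominatedWidth D num (graph F) ≤ totalWidth D A - totalWidth D F := by
  have hmono : ∀ u v, (graph A).Reachable u v → (graph F).Reachable u v :=
    fun u v h => h.mono (graph_mono hAF)
  have hall : ∑ i, width D (num.symm i).supp ≤ totalWidth D A :=
    sum_comp_le_sum (g := num.symm) (f := fun K => width D K.supp)
      (fun i _ => mem_componentsMeeting_univ _) num.symm.injective fun _ => width_nonneg _ _
  -- Each component of `F` is represented by a vertex of largest number. By feasibility a widest
  -- terminal pair lies in one component of `A`, so the component of the leader is at least as wide.
  -- Leaders are undominated and have distinct numbers.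
  have hlead : ∀ K : (graph F).ConnectedComponent, ∃ v, (graph F).connectedComponentMk v = K ∧
      ∀ u, (graph F).Reachable v u → compIndex num u ≤ compIndex num v := by
    intro K
    obtain ⟨m, rfl⟩ := K.exists_rep
    obtain ⟨v, hv, hmax⟩ := exists_leader num (graph F) m
    exact ⟨v, SimpleGraph.ConnectedComponent.eq.2 hv.symm, fun u hu => hmax u (hv.trans hu)⟩
  choose g hg hmax using hlead
  have hwidth : ∀ K : (graph F).ConnectedComponent,
      width D K.supp ≤ width D (num.symm (compIndex num (g K))).supp := by
    intro K
    obtain ⟨a, ha, hle⟩ := exists_width_le_width hA K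
    refine hle.trans ?_
    have h1 := hnum _ _ (hmax K a (SimpleGraph.ConnectedComponent.eq.1 ((hg K).trans ha.symm)))
    rwa [compIndex, Equiv.symm_apply_apply] at h1
  have hinj : Function.Injective fun K => compIndex num (g K) := by
    intro K₁ K₂ h
    rw [← hg K₁, ← hg K₂]
    exact SimpleGraph.ConnectedComponent.eq.2 (hmono _ _ (compIndex_eq_iff.1 h))
  have hF : totalWidth D F ≤ ∑ i ∈ Finset.univ \ dominated num (graph F),
      width D (num.symm i).supp := by
    refine (Finset.sum_le_sum fun K _ => hwidth K).trans ?_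
    refine sum_comp_le_sum (g := fun K => compIndex num (g K))
      (f := fun i => width D (num.symm i).supp) (fun K _ => ?_) hinj fun _ => width_nonneg _ _
    refine Finset.mem_sdiff.2 ⟨Finset.mem_univ _, fun hmem => ?_⟩
    obtain ⟨u, v, hu, hv, huv⟩ := mem_dominated.1 hmem
    exact absurd hv (not_lt.2 (hmax K v ((hmono _ _ (compIndex_eq_iff.1 hu.symm)).trans huv)))
  have hsplit := Finset.sum_sdiff (f := fun i => width D (num.symm i).supp)
    (Finset.subset_univ (dominated num (graph F)))
  unfold dominatedWidth
  linarith

end Dominated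

/-! ### From connecting trees to arbitrary edge sets -/

section Connecting

variable {V : Type*} {A : Finset (Sym2 V)}

/-- Translates the tree conditions, which live in the contracted graph, into reachability in `A ∪
T`, where edges can be dropped one at a time. -/
theorem reachable_union_iff [DecidableEq (Sym2 V)] {T : Finset (Sym2 V)} {u v : V} :
    (graph (A ∪ T)).Reachable u v ↔ (contractedGraph A T).Reachable
      ((graph A).connectedComponentMk u) ((graph A).connectedComponentMk v) := by
  have hmono : graph A ≤ graph (A ∪ T) := graph_mono Finset.subset_union_left
  constructor
  · rintro ⟨q⟩
    induction q with
    | nil => exact SimpleGraph.Reachable.refl _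
    | @cons a b _ hadj _ ih =>
      refine SimpleGraph.Reachable.trans ?_ ih
      by_cases hab : (graph A).connectedComponentMk a = (graph A).connectedComponentMk b
      · rw [hab]
      · simp only [graph, SimpleGraph.fromEdgeSet_adj, Finset.mem_coe, Finset.mem_union] at hadj
        rcases hadj with ⟨hadj | hadj, hne⟩
        · exact absurd (SimpleGraph.ConnectedComponent.eq.2 (SimpleGraph.Adj.reachable
            ((SimpleGraph.fromEdgeSet_adj _).2 ⟨hadj, hne⟩))) hab
        · exact SimpleGraph.Adj.reachable ((SimpleGraph.fromEdgeSet_adj _).2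
            ⟨⟨s(a, b), hadj, rfl⟩, hab⟩)
  · rintro ⟨q⟩
    generalize hK : (graph A).connectedComponentMk u = K at q
    generalize hK' : (graph A).connectedComponentMk v = K' at q
    induction q generalizing u with
    | nil => exact (SimpleGraph.ConnectedComponent.eq.1 (hK.trans hK'.symm)).mono hmono
    | @cons K₁ K₂ _ hadj _ ih =>
      obtain ⟨⟨e, he, heq⟩, hne⟩ := (SimpleGraph.fromEdgeSet_adj _).1 hadj
      have key : ∀ a b, s(a, b) ∈ T → (graph (A ∪ T)).Reachable a b := by
        intro a b hab
        by_cases hne : a = b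
        · rw [hne]
        · refine SimpleGraph.Adj.reachable ((SimpleGraph.fromEdgeSet_adj _).2 ⟨?_, hne⟩)
          exact Finset.mem_coe.2 (Finset.mem_union_right _ hab)
      induction e with
      | h a b =>
        rw [Sym2.map_mk, Sym2.eq_iff] at heq
        rcases heq with ⟨h1, h2⟩ | ⟨h1, h2⟩
        · exact (((SimpleGraph.ConnectedComponent.eq.1 (hK.trans h1.symm)).mono hmono).trans
            (key a b he)).trans (ih h2 hK')
        · exact (((SimpleGraph.ConnectedComponent.eq.1 (hK.trans h2.symm)).mono hmono).trans
            (key a b he).symm).trans (ih h1 hK')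

theorem totalLength_mono [PseudoMetricSpace V] {T T' : Finset (Sym2 V)} (h : T ⊆ T') :
    totalLength T ≤ totalLength T' :=
  Finset.sum_le_sum_of_subset_of_nonneg h fun _ _ _ => NNReal.coe_nonneg _

/-- If no proper subset of a nonempty edge set connects the same vertices, and it is connected,
then it is a connecting tree. -/
theorem isConnectingTree_of_minimal [DecidableEq (Sym2 V)] {T : Finset (Sym2 V)}
    (hne : T.Nonempty)
    (hmin : ∀ a b, s(a, b) ∈ T → ¬ (graph (A ∪ T.erase s(a, b))).Reachable a b)
    (hconn : ∀ e ∈ T, ∀ f ∈ T, ∀ x ∈ e, ∀ y ∈ f, (graph (A ∪ T)).Reachable x y) :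
    IsConnectingTree A T where
  nonempty := hne
  no_loop := by
    intro e he hdiag
    induction e with
    | h a b =>
      rw [Sym2.map_mk, Sym2.mk_isDiag_iff] at hdiag
      exact hmin a b he ((SimpleGraph.ConnectedComponent.eq.1 hdiag).mono
        (graph_mono Finset.subset_union_left))
  no_parallel := by
    intro e he f hf hef
    by_contra hne
    induction e with
    | h a b =>
      refine hmin a b he (reachable_union_iff.2 ?_)
      have hadj : Sym2.map (graph A).connectedComponentMk s(a, b) ∈
          Sym2.map (graph A).connectedComponentMk '' (T.erase s(a, b) : Set (Sym2 V)) :=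
        ⟨f, Finset.mem_coe.2 (Finset.mem_erase.2 ⟨Ne.symm hne, hf⟩), hef.symm⟩
      by_cases hab : (graph A).connectedComponentMk a = (graph A).connectedComponentMk b
      · rw [hab]
      · exact SimpleGraph.Adj.reachable ((SimpleGraph.fromEdgeSet_adj _).2 ⟨hadj, hab⟩)
  acyclic := by
    rw [SimpleGraph.isAcyclic_iff_forall_isBridge]
    intro ε hε
    obtain ⟨⟨e, he, rfl⟩, -⟩ := (Set.ext_iff.1 (SimpleGraph.edgeSet_fromEdgeSet _) ε).1 hε
    induction e with
    | h a b =>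
      rw [Sym2.map_mk, SimpleGraph.isBridge_iff]
      -- Deleting a contracted edge deletes all of its preimages, so what is left is also present
      -- after erasing `s(a, b)` alone.
      refine fun h => hmin a b he (reachable_union_iff.2 (h.mono fun K K' hKK => ?_))
      obtain ⟨hadj, hnot⟩ := SimpleGraph.deleteEdges_adj.1 hKK
      obtain ⟨⟨f, hf, hfK⟩, hK⟩ := (SimpleGraph.fromEdgeSet_adj _).1 hadj
      refine (SimpleGraph.fromEdgeSet_adj _).2 ⟨⟨f, ?_, hfK⟩, hK⟩
      refine Finset.mem_coe.2 (Finset.mem_erase.2 ⟨?_, hf⟩)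
      rintro rfl
      exact hnot hfK.symm
  connected := fun e he f hf x hx y hy => reachable_union_iff.1 (hconn e he f hf x hx y hy)

/-- Without connecting moves, the dominated width is bounded for all sets of added edges. -/
theorem ConnectingMoveOptimal.dominatedWidth_le [Fintype V] [DecidableEq (Sym2 V)]
    [PseudoMetricSpace V]
    {D : Finset (Sym2 V)} (hA : Feasible D A) {p : ℕ}
    {num : (graph A).ConnectedComponent ≃ Fin p}
    (hnum : ∀ i j : Fin p, i ≤ j → width D (num.symm i).supp ≤ width D (num.symm j).supp)
    {c : ℝ} (hc : 0 ≤ c) (hconn : ConnectingMoveOptimal D A c) (T : Finset (Sym2 V)) :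
    dominatedWidth D num (graph (A ∪ T)) ≤ c * totalLength T := by
  classical
  induction T using Finset.strongInduction with
  | H T ih =>
    -- An edge whose ends stay connected without it can be dropped. If there is none, a connected
    -- nonempty `T` is a tree and therefore not a connecting move, and a disconnected one is split
    -- in two.
    by_cases hredundant : ∃ a b, s(a, b) ∈ T ∧ (graph (A ∪ T.erase s(a, b))).Reachable a b
    · obtain ⟨a, b, hab, hreach⟩ := hredundant
      calc _ ≤ dominatedWidth D num (graph (A ∪ T.erase s(a, b))) := by
            refine dominatedWidth_mono _ _ fun u v huv => huv.of_forall_adj fun x y hxy => ?_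
            obtain ⟨hmem, hne⟩ := (SimpleGraph.fromEdgeSet_adj _).1 hxy
            by_cases he : s(x, y) = s(a, b)
            · rcases Sym2.eq_iff.1 he with ⟨rfl, rfl⟩ | ⟨rfl, rfl⟩
              · exact hreach
              · exact hreach.symm
            · refine SimpleGraph.Adj.reachable ((SimpleGraph.fromEdgeSet_adj _).2 ⟨?_, hne⟩)
              simp only [Finset.mem_coe, Finset.mem_union, Finset.mem_erase] at hmem ⊢
              tauto
        _ ≤ c * totalLength (T.erase s(a, b)) := ih _ (Finset.erase_ssubset hab)
        _ ≤ _ := mul_le_mul_of_nonneg_left (totalLength_mono (Finset.erase_subset _ _)) hc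
    push Not at hredundant
    rcases T.eq_empty_or_nonempty with rfl | hne
    · have h := dominatedWidth_le_sub hA hnum (Finset.subset_union_left (s₁ := A) (s₂ := ∅))
      rw [Finset.union_empty, sub_self] at h
      simpa [totalLength] using h
    by_cases hcon : ∀ e ∈ T, ∀ f ∈ T, ∀ x ∈ e, ∀ y ∈ f, (graph (A ∪ T)).Reachable x y
    · have h := hconn T (isConnectingTree_of_minimal hne hredundant hcon)
      have h' := dominatedWidth_le_sub hA hnum (Finset.subset_union_left (s₁ := A) (s₂ := T))
      have h'' : ¬ c * totalLength T ≤ totalWidth D A - totalWidth D (A ∪ T) := by convert h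
      linarith
    · push Not at hcon
      obtain ⟨e, he, f, hf, x, hx, y, hy, hxy⟩ := hcon
      have hedge : ∀ q ∈ T, ∀ a ∈ q, ∀ b ∈ q, (graph (A ∪ T)).Reachable a b := by
        intro q hq a ha b hb
        by_cases hab : a = b
        · rw [hab]
        · refine SimpleGraph.Adj.reachable ((SimpleGraph.fromEdgeSet_adj _).2 ⟨?_, hab⟩)
          rw [← (Sym2.mem_and_mem_iff hab).1 ⟨ha, hb⟩]
          exact Finset.mem_coe.2 (Finset.mem_union_right _ hq)
      -- `T₁` is the part of `T` in the component of `x`. A walk in `A ∪ T` stays on one side, so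
      -- each dominated index is already dominated with `T₁` or with `T₂`.
      set T₁ := T.filter fun q => ∃ z ∈ q, (graph (A ∪ T)).Reachable x z with hT₁
      set T₂ := T.filter fun q => ¬ ∃ z ∈ q, (graph (A ∪ T)).Reachable x z with hT₂
      have h₁ : T₁ ⊂ T := by
        refine Finset.filter_ssubset.2 ⟨f, hf, ?_⟩
        rintro ⟨z, hz, hxz⟩
        exact hxy (hxz.trans (hedge f hf z hz y hy))
      have h₂ : T₂ ⊂ T := by
        refine Finset.filter_ssubset.2 ⟨e, he, ?_⟩
        exact not_not.2 ⟨x, hx, SimpleGraph.Reachable.refl x⟩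
      have hlen : totalLength T₁ + totalLength T₂ = totalLength T :=
        Finset.sum_filter_add_sum_filter_not T _ _
      have hsub : dominated num (graph (A ∪ T)) ⊆
          dominated num (graph (A ∪ T₁)) ∪ dominated num (graph (A ∪ T₂)) := by
        intro i hi
        obtain ⟨u, v, hu, hv, huv⟩ := mem_dominated.1 hi
        by_cases hxu : (graph (A ∪ T)).Reachable x u
        · refine Finset.mem_union_left _ (mem_dominated.2 ⟨u, v, hu, hv, ?_⟩)
          refine SimpleGraph.reachable_of_closed huv fun a b ha hab => ?_
          obtain ⟨hmem, hne⟩ := (SimpleGraph.fromEdgeSet_adj _).1 hab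
          refine SimpleGraph.Adj.reachable ((SimpleGraph.fromEdgeSet_adj _).2 ⟨?_, hne⟩)
          rcases Finset.mem_union.1 (Finset.mem_coe.1 hmem) with h | h
          · exact Finset.mem_coe.2 (Finset.mem_union_left _ h)
          · refine Finset.mem_coe.2 (Finset.mem_union_right _ (Finset.mem_filter.2 ⟨h, a,
              Sym2.mem_mk_left _ _, hxu.trans (ha.mono (graph_mono ?_))⟩))
            exact Finset.union_subset_union_right h₁.1
        · refine Finset.mem_union_right _ (mem_dominated.2 ⟨u, v, hu, hv, ?_⟩)
          refine SimpleGraph.reachable_of_closed huv fun a b ha hab => ?_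
          obtain ⟨hmem, hne⟩ := (SimpleGraph.fromEdgeSet_adj _).1 hab
          refine SimpleGraph.Adj.reachable ((SimpleGraph.fromEdgeSet_adj _).2 ⟨?_, hne⟩)
          rcases Finset.mem_union.1 (Finset.mem_coe.1 hmem) with h | h
          · exact Finset.mem_coe.2 (Finset.mem_union_left _ h)
          · refine Finset.mem_coe.2 (Finset.mem_union_right _ (Finset.mem_filter.2 ⟨h, ?_⟩))
            rintro ⟨z, hz, hxz⟩
            have hza := hedge _ h z hz a (Sym2.mem_mk_left _ _)
            exact hxu ((hxz.trans hza).trans (ha.mono (graph_mono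
              (Finset.union_subset_union_right h₂.1))).symm)
      have hsum : dominatedWidth D num (graph (A ∪ T)) ≤
          dominatedWidth D num (graph (A ∪ T₁)) + dominatedWidth D num (graph (A ∪ T₂)) := by
        refine (Finset.sum_le_sum_of_subset_of_nonneg hsub fun _ _ _ => width_nonneg _ _).trans ?_
        unfold dominatedWidth
        rw [← Finset.sum_union_inter]
        exact le_add_of_nonneg_right (Finset.sum_nonneg fun _ _ => width_nonneg _ _)
      have := ih T₁ h₁
      have := ih T₂ h₂
      rw [← hlen, mul_add]
      linarith

end Connecting

end SteinerForest

/-! ### Super edges and the walks they form -/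

namespace SteinerForest

/-- A connection from `src` to `tgt` that was obtained by merging edges of a walk: `path` is a
contracted walk from `src` to `tgt`, `cost` is what is left to pay for widths. -/
structure SuperEdge (V : Type*) where
  src : V
  tgt : V
  cost : ℝ
  path : List (V × V)

section Link

variable {V : Type*} {A : Finset (Sym2 V)}

/-- The graph formed by `A` and the super edges in `E`. -/
def linkGraph (A : Finset (Sym2 V)) (E : List (SuperEdge V)) : SimpleGraph V :=
  SimpleGraph.fromEdgeSet {e | e ∈ A ∨ ∃ x ∈ E, e = s(x.src, x.tgt)}

theorem graph_le_linkGraph (E : List (SuperEdge V)) : graph A ≤ linkGraph A E :=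
  SimpleGraph.fromEdgeSet_mono fun _ he => Or.inl he

theorem linkGraph_mono {E E' : List (SuperEdge V)} (h : E ⊆ E') :
    linkGraph A E ≤ linkGraph A E' := by
  refine SimpleGraph.fromEdgeSet_mono ?_
  rintro e (he | ⟨x, hx, rfl⟩)
  · exact Or.inl he
  · exact Or.inr ⟨x, h hx, rfl⟩

theorem linkGraph_reachable {E : List (SuperEdge V)} {x : SuperEdge V} (hx : x ∈ E) :
    (linkGraph A E).Reachable x.src x.tgt := by
  by_cases h : x.src = x.tgt
  · rw [h]
  · exact SimpleGraph.Adj.reachable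
      ((SimpleGraph.fromEdgeSet_adj _).2 ⟨Or.inr ⟨x, hx, rfl⟩, h⟩)

theorem reachable_of_linkGraph {E : List (SuperEdge V)} {G : SimpleGraph V} (hA : graph A ≤ G)
    (hE : ∀ x ∈ E, G.Reachable x.src x.tgt) {u v : V} (h : (linkGraph A E).Reachable u v) :
    G.Reachable u v := by
  refine h.of_forall_adj fun a b hab => ?_
  obtain ⟨h | ⟨x, hx, hxe⟩, hne⟩ := (SimpleGraph.fromEdgeSet_adj _).1 hab
  · exact (hA ((SimpleGraph.fromEdgeSet_adj _).2 ⟨h, hne⟩)).reachable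
  · rcases Sym2.eq_iff.1 hxe with ⟨rfl, rfl⟩ | ⟨rfl, rfl⟩
    · exact hE x hx
    · exact (hE x hx).symm

/-- The super edges in the list form a walk from `s` to `t` together with connections in `G`. -/
def IsJoined (G : SimpleGraph V) : V → List (SuperEdge V) → V → Prop
  | s, [], t => G.Reachable s t
  | s, x :: E, t => G.Reachable s x.src ∧ IsJoined G x.tgt E t

theorem IsJoined.mono {G G' : SimpleGraph V} (h : G ≤ G') {s t : V} {E : List (SuperEdge V)}
    (hE : IsJoined G s E t) : IsJoined G' s E t := by
  induction E generalizing s with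
  | nil => exact SimpleGraph.Reachable.mono h hE
  | cons x E ih => exact ⟨hE.1.mono h, ih hE.2⟩

theorem IsJoined.trans_left {G : SimpleGraph V} {s s' t : V} {E : List (SuperEdge V)}
    (hs : G.Reachable s s') (hE : IsJoined G s' E t) : IsJoined G s E t := by
  cases E with
  | nil => exact SimpleGraph.Reachable.trans hs hE
  | cons x E => exact ⟨hs.trans hE.1, hE.2⟩

theorem isJoined_append {G : SimpleGraph V} {s t : V} {E E' : List (SuperEdge V)} :
    IsJoined G s (E ++ E') t ↔ ∃ m, IsJoined G s E m ∧ IsJoined G m E' t := by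
  induction E generalizing s with
  | nil =>
    exact ⟨fun h => ⟨s, SimpleGraph.Reachable.refl s, h⟩,
      fun ⟨m, hm, h⟩ => IsJoined.trans_left hm h⟩
  | cons x E ih =>
    simp only [List.cons_append, IsJoined, ih]
    tauto

theorem IsJoined.exists_reachable {G : SimpleGraph V} {s t : V} {E : List (SuperEdge V)}
    (hE : IsJoined G s E t) : G.Reachable s t ∨ ∃ x ∈ E, G.Reachable x.tgt t := by
  induction E generalizing s with
  | nil => exact Or.inl hE
  | cons x E ih =>
    rcases ih hE.2 with h | ⟨y, hy, h⟩
    · exact Or.inr ⟨x, by simp, h⟩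
    · exact Or.inr ⟨y, by simp [hy], h⟩

/-- A walk that starts downwards and ends at the top without staying at one height has a local
minimum. -/
theorem exists_local_min {p : ℕ} {num : (graph A).ConnectedComponent ≃ Fin p} {G : SimpleGraph V}
    (hG : ∀ u v, G.Reachable u v → (graph A).Reachable u v) {t : V} {x : SuperEdge V}
    {E : List (SuperEdge V)} (hE : IsJoined G x.tgt E t)
    (htop : compIndex num x.src ≤ compIndex num t)
    (htop' : ∀ y ∈ E, compIndex num y.src ≤ compIndex num t)
    (hx : compIndex num x.tgt < compIndex num x.src)
    (hne : ∀ y ∈ E, compIndex num y.src ≠ compIndex num y.tgt) :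
    ∃ pre y z post, x :: E = pre ++ y :: z :: post ∧ compIndex num y.tgt < compIndex num y.src ∧
      compIndex num z.src < compIndex num z.tgt := by
  -- If nothing followed `x`, the walk would end below the top. Otherwise the next super edge goes
  -- up, or it goes down and the search continues from it.
  induction E generalizing x with
  | nil => exact absurd (compIndex_eq_iff.2 (hG _ _ hE)) (hx.trans_le htop).ne
  | cons y E ih =>
    rcases lt_or_gt_of_ne (hne y (by simp)) with h | h
    · exact ⟨[], x, y, E, rfl, hx, h⟩
    · obtain ⟨pre, y', z', post, heq, h1, h2⟩ := ih hE.2 (htop' y (by simp))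
        (fun z hz => htop' z (by simp [hz])) h fun z hz => hne z (by simp [hz])
      exact ⟨x :: pre, y', z', post, by rw [heq]; rfl, h1, h2⟩

end Link

/-! ### Merging super edges at a local minimum -/

section Merge

variable {V : Type*} {A : Finset (Sym2 V)} {p : ℕ}

/-- `x` is a super edge with ends in `W` and edges from `E₀`, all of whose inner components have
smaller numbers than its ends, which have numbers at most `top`. -/
structure IsSuperEdge (num : (graph A).ConnectedComponent ≃ Fin p) (E₀ : Finset (Sym2 V))
    (W : Set V) (top : Fin p) (x : SuperEdge V) : Prop where
  walk : IsContractedWalk A x.src x.tgt x.path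
  edges : ∀ y ∈ x.path, s(y.1, y.2) ∈ E₀
  tail : ∀ y ∈ x.path.tail, compIndex num y.1 < compIndex num x.src ∧
    compIndex num y.1 < compIndex num x.tgt
  dropLast : ∀ y ∈ x.path.dropLast, compIndex num y.2 < compIndex num x.src ∧
    compIndex num y.2 < compIndex num x.tgt
  src_mem : x.src ∈ W
  tgt_mem : x.tgt ∈ W
  src_le : compIndex num x.src ≤ top
  tgt_le : compIndex num x.tgt ≤ top

/-- The super edge that combines two consecutive super edges and pays `r`. -/
def SuperEdge.merge (x y : SuperEdge V) (r : ℝ) : SuperEdge V :=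
  ⟨x.src, y.tgt, x.cost + y.cost - r, x.path ++ y.path⟩

/-- The interior of `x` is below `x.tgt`, hence below `y.tgt`; the interior of `y` is below `y.src`,
hence below `x.src`. The meeting point becomes interior itself, which needs both `hdown` and `hup`
to be strict. -/
theorem IsSuperEdge.merge {num : (graph A).ConnectedComponent ≃ Fin p} {E₀ : Finset (Sym2 V)}
    {W : Set V} {top : Fin p} {x y : SuperEdge V} (hx : IsSuperEdge num E₀ W top x)
    (hy : IsSuperEdge num E₀ W top y) (hxy : (graph A).Reachable x.tgt y.src)
    (hdown : compIndex num x.tgt < compIndex num x.src)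
    (hup : compIndex num y.src < compIndex num y.tgt) (r : ℝ) :
    IsSuperEdge num E₀ W top (x.merge y r) := by
  have heq := (compIndex_eq_iff (num := num)).2 hxy
  refine ⟨hx.walk.append hy.walk hxy, ?_, ?_, ?_, hx.src_mem, hy.tgt_mem, hx.src_le, hy.tgt_le⟩
  · intro z hz
    rcases List.mem_append.1 hz with h | h
    · exact hx.edges z h
    · exact hy.edges z h
  · intro z hz
    change compIndex num z.1 < compIndex num x.src ∧ compIndex num z.1 < compIndex num y.tgt
    change z ∈ (x.path ++ y.path).tail at hz
    rw [List.tail_append_of_ne_nil hx.walk.ne_nil] at hz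
    rcases List.mem_append.1 hz with h | h
    · have := hx.tail z h
      exact ⟨this.1, this.2.trans (heq ▸ hup)⟩
    · obtain ⟨w, l, hl⟩ := hy.walk.exists_cons
      rw [hl] at h
      rcases List.mem_cons.1 h with rfl | h
      · exact ⟨heq ▸ hdown, hup⟩
      · have := hy.tail z (by rw [hl]; exact h)
        exact ⟨this.1.trans (heq ▸ hdown), this.2⟩
  · intro z hz
    change compIndex num z.2 < compIndex num x.src ∧ compIndex num z.2 < compIndex num y.tgt
    change z ∈ (x.path ++ y.path).dropLast at hz
    rw [List.dropLast_append_of_ne_nil hy.walk.ne_nil] at hz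
    rcases List.mem_append.1 hz with h | h
    · obtain ⟨w, l, hl⟩ := hx.walk.exists_concat
      rw [hl] at h
      rcases List.mem_append.1 h with h | h
      · have := hx.dropLast z (by rw [hl, List.dropLast_concat]; exact h)
        exact ⟨this.1, this.2.trans (heq ▸ hup)⟩
      · rw [List.mem_singleton.1 h]
        exact ⟨hdown, heq ▸ hup⟩
    · have := hy.dropLast z h
      exact ⟨this.1.trans (heq ▸ hdown), this.2⟩

variable [PseudoMetricSpace V]

/-- Replacing two super edges that meet in a local minimum by the merged super edge, which pays
for the width of the local minimum, preserves the bound on the dominated width. -/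
theorem dominatedWidth_merge_le [Finite V] {D : Finset (Sym2 V)}
    {num : (graph A).ConnectedComponent ≃ Fin p}
    (hnum : ∀ i j : Fin p, i ≤ j → width D (num.symm i).supp ≤ width D (num.symm j).supp)
    {x y : SuperEdge V} {pre post : List (SuperEdge V)} (hxy : (graph A).Reachable x.tgt y.src)
    (hdown : compIndex num x.tgt < compIndex num x.src)
    (hup : compIndex num y.src < compIndex num y.tgt)
    (H : ∀ E, E.Sublist (pre ++ x :: y :: post) →
      dominatedWidth D num (linkGraph A E) ≤ (E.map SuperEdge.cost).sum)
    {E : List (SuperEdge V)}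
    (hE : E.Sublist
      (pre ++ x.merge y (width D (num.symm (compIndex num x.tgt)).supp) :: post)) :
    dominatedWidth D num (linkGraph A E) ≤ (E.map SuperEdge.cost).sum := by
  have heq := (compIndex_eq_iff (num := num)).2 hxy
  obtain ⟨p', q, rfl, hp', hq⟩ := List.sublist_append_iff.1 hE
  rcases List.sublist_cons_iff.1 hq with hq | ⟨q', rfl, hq'⟩
  · exact H _ (hp'.append ((hq.cons _).cons _))
  set r := width D (num.symm (compIndex num x.tgt)).supp with hr
  have hAG : ∀ E : List (SuperEdge V), ∀ u v, (graph A).Reachable u v →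
      (linkGraph A E).Reachable u v := fun E u v h => h.mono (graph_le_linkGraph E)
  have hcost : ((p' ++ x.merge y r :: q').map SuperEdge.cost).sum =
      ((p' ++ q').map SuperEdge.cost).sum + x.cost + y.cost - r := by
    simp only [List.map_append, List.map_cons, List.sum_append, List.sum_cons, SuperEdge.merge]
    ring
  rw [hcost]
  -- If the other edges already connect the minimum to `x.src`, then `y` does the work of the merged
  -- edge, and the invariant for `[x]` alone shows that `x.cost` covers `r`.
  by_cases hx : (linkGraph A (p' ++ q')).Reachable x.tgt x.src
  · have h1 := H [x] (List.singleton_sublist.2 (by simp))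
    have h2 : r ≤ dominatedWidth D num (linkGraph A [x]) :=
      width_le_dominatedWidth D num (linkGraph_reachable (x := x) (by simp)).symm hdown
    have h3 := H (p' ++ y :: q') (hp'.append ((hq'.cons_cons y).cons _))
    have h4 : dominatedWidth D num (linkGraph A (p' ++ x.merge y r :: q')) ≤
        dominatedWidth D num (linkGraph A (p' ++ y :: q')) := by
      refine dominatedWidth_mono _ _ fun u v huv =>
        reachable_of_linkGraph (graph_le_linkGraph _) (fun z hz => ?_) huv
      by_cases hzf : z = x.merge y r
      · subst hzf
        exact ((hx.symm.mono (linkGraph_mono (by simp))).trans (hAG _ _ _ hxy)).trans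
          (linkGraph_reachable (by simp))
      · refine linkGraph_reachable ?_
        simp only [List.mem_append, List.mem_cons] at hz ⊢
        tauto
    simp only [List.map_append, List.map_cons, List.sum_append, List.sum_cons, List.map_nil,
      List.sum_nil] at h1 h3 ⊢
    linarith
  by_cases hy : (linkGraph A (p' ++ q')).Reachable x.tgt y.tgt
  · have h1 := H [y] (List.singleton_sublist.2 (by simp))
    have h2 : r ≤ dominatedWidth D num (linkGraph A [y]) := by
      rw [hr, heq]
      exact width_le_dominatedWidth D num (linkGraph_reachable (x := y) (by simp)) hup
    have h3 := H (p' ++ x :: q') (hp'.append ((hq'.cons y).cons_cons x))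
    have h4 : dominatedWidth D num (linkGraph A (p' ++ x.merge y r :: q')) ≤
        dominatedWidth D num (linkGraph A (p' ++ x :: q')) := by
      refine dominatedWidth_mono _ _ fun u v huv =>
        reachable_of_linkGraph (graph_le_linkGraph _) (fun z hz => ?_) huv
      by_cases hzf : z = x.merge y r
      · subst hzf
        exact SimpleGraph.Reachable.trans (linkGraph_reachable (x := x) (by simp))
          (hy.mono (linkGraph_mono (by simp)))
      · refine linkGraph_reachable ?_
        simp only [List.mem_append, List.mem_cons] at hz ⊢
        tauto
    simp only [List.map_append, List.map_cons, List.sum_append, List.sum_cons, List.map_nil,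
      List.sum_nil] at h1 h3 ⊢
    linarith
  -- Now the merged edge bypasses the component of the minimum. Using `x` and `y` in its place
  -- connects that component as well, which adds at least `r` to the dominated width; the merged
  -- edge is cheaper by exactly `r`.
  · have h3 := H (p' ++ x :: y :: q') (hp'.append ((hq'.cons_cons y).cons_cons x))
    have hxG := linkGraph_reachable (A := A) (E := p' ++ x :: y :: q') (x := x) (by simp)
    have hyG := linkGraph_reachable (A := A) (E := p' ++ x :: y :: q') (x := y) (by simp)
    have h4 : dominatedWidth D num (linkGraph A (p' ++ x.merge y r :: q')) + r ≤
        dominatedWidth D num (linkGraph A (p' ++ x :: y :: q')) := by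
      refine dominatedWidth_add_le hnum (hAG _) (fun u v huv =>
        reachable_of_linkGraph (graph_le_linkGraph _) (fun z hz => ?_) huv) ?_ hxG.symm hdown.le
      · by_cases hzf : z = x.merge y r
        · subst hzf
          exact (hxG.trans (hAG _ _ _ hxy)).trans hyG
        · refine linkGraph_reachable ?_
          simp only [List.mem_append, List.mem_cons] at hz ⊢
          tauto
      -- To use the merged edge, a walk from `x.tgt` must first reach one of its ends by other
      -- edges, which `hx` and `hy` exclude.
      · refine fun h => hx (SimpleGraph.reachable_of_closed h fun a b ha hab => ?_)
        obtain ⟨h | ⟨z, hz, hze⟩, hne⟩ := (SimpleGraph.fromEdgeSet_adj _).1 hab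
        · exact (graph_le_linkGraph _ ((SimpleGraph.fromEdgeSet_adj _).2 ⟨h, hne⟩)).reachable
        · by_cases hzf : z = x.merge y r
          · subst hzf
            rcases Sym2.eq_iff.1 hze with ⟨rfl, -⟩ | ⟨rfl, -⟩
            · exact absurd ha hx
            · exact absurd ha hy
          · refine SimpleGraph.Adj.reachable
              ((SimpleGraph.fromEdgeSet_adj _).2 ⟨Or.inr ⟨z, ?_, hze⟩, hne⟩)
            simp only [List.mem_append, List.mem_cons] at hz ⊢
            tauto
    simp only [List.map_append, List.map_cons, List.sum_append, List.sum_cons] at h3 ⊢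
    linarith

/-- The edge that replaces a super edge within a component is swap-optimal in both directions. -/
theorem IsSuperEdge.potential_le [Fintype V] [DecidableEq (Sym2 V)] {κ : RemovalRule}
    {D E₀ : Finset (Sym2 V)} (hA : IsSteinerForest D A) (hpath : PathSetSwapOptimal κ D A E₀)
    {num : (graph A).ConnectedComponent ≃ Fin p} {W : Set V} {top : Fin p} {x : SuperEdge V}
    (hx : IsSuperEdge num E₀ W top x) (hloop : compIndex num x.src = compIndex num x.tgt)
    (hne : x.src ≠ x.tgt) {u v : V} (huv : s(u, v) = s(x.src, x.tgt)) {S : Finset (Sym2 V)}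
    (hS : IsRemovalSet κ D A u v S) :
    potential D A ≤
      totalLength (A \ S) + contractedLength x.path + totalWidth D (insert s(u, v) (A \ S)) := by
  rcases Sym2.eq_iff.1 huv with ⟨rfl, rfl⟩ | ⟨rfl, rfl⟩
  · exact hpath.potential_le hA hne (compIndex_eq_iff.1 hloop) hx.walk hx.edges
      (fun y hy h => (hx.tail y hy).1.ne' (compIndex_eq_iff.2 h)) hS
  -- In the other orientation the walk is reversed, and the condition on starts of later edges
  -- becomes the one recorded in `dropLast`.
  · rw [← contractedLength_reverse]
    refine hpath.potential_le hA hne.symm (compIndex_eq_iff.1 hloop.symm) hx.walk.reverse ?_ ?_ hS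
    · intro y hy
      obtain ⟨z, hz, rfl⟩ := List.mem_map.1 hy
      rw [Prod.fst_swap, Prod.snd_swap, Sym2.eq_swap]
      exact hx.edges z (List.mem_reverse.1 hz)
    · intro y hy h
      rw [← List.map_tail, List.tail_reverse] at hy
      obtain ⟨z, hz, rfl⟩ := List.mem_map.1 hy
      exact (hx.dropLast z (List.mem_reverse.1 hz)).2.ne' (compIndex_eq_iff.2 h)

end Merge

end SteinerForest

/-! ### Eliminating all super edges -/

namespace SteinerForest

variable {V : Type*} [Fintype V] [PseudoMetricSpace V] {A : Finset (Sym2 V)} {p : ℕ}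

theorem EdgeSetSwapOptimal.insert [DecidableEq (Sym2 V)] {κ : RemovalRule}
    {D R : Finset (Sym2 V)} {ℓ : Sym2 V → ℝ≥0} (hR : EdgeSetSwapOptimal κ D A R ℓ)
    {e : Sym2 V} {r : ℝ≥0}
    (he : ∀ u v, s(u, v) = e → ∀ S, IsRemovalSet κ D A u v S →
      potential D A ≤ totalLength (A \ S) + r + totalWidth D (insert s(u, v) (A \ S))) :
    EdgeSetSwapOptimal κ D A (insert e R) (Function.update ℓ e r) := by
  intro u v huv S hS
  by_cases h : s(u, v) = e
  · rw [h, Function.update_self, ← h]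
    convert he u v h S hS
  · rw [Function.update_of_ne h]
    exact hR u v ((Finset.mem_insert.1 huv).resolve_left h) S hS

/-- A list of super edges that forms a closed walk from the top component to itself can be
replaced by edges within components, while all other components that are visited are paid. -/
theorem exists_inner_edges [DecidableEq (Sym2 V)] {κ : RemovalRule} {D E₀ : Finset (Sym2 V)}
    (hA : IsSteinerForest D A) (hpath : PathSetSwapOptimal κ D A E₀)
    {num : (graph A).ConnectedComponent ≃ Fin p}
    (hnum : ∀ i j : Fin p, i ≤ j → width D (num.symm i).supp ≤ width D (num.symm j).supp)
    {W : Set V} {top : Fin p} (n : ℕ) (E : List (SuperEdge V)) (hn : E.length = n)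
    (B : Finset (Sym2 V)) (hB : ∀ u v, (graph B).Reachable u v → (graph A).Reachable u v)
    {s t : V} (hs : compIndex num s = top) (ht : compIndex num t = top)
    (hjoin : IsJoined (graph B) s E t) (hE : ∀ x ∈ E, IsSuperEdge num E₀ W top x)
    (H : ∀ E', E'.Sublist E →
      dominatedWidth D num (linkGraph A E') ≤ (E'.map SuperEdge.cost).sum) :
    ∃ (R : Finset (Sym2 V)) (ℓ : Sym2 V → ℝ≥0) (Z : List V),
      (∀ e ∈ R, ¬ e.IsDiag ∧ (∀ x ∈ e, x ∈ W) ∧ Inside A e) ∧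
      EdgeSetSwapOptimal κ D A R ℓ ∧
      ∑ e ∈ R, (ℓ e : ℝ) ≤ (E.map fun x => contractedLength x.path).sum ∧
      (Z.map fun z => width D (num.symm (compIndex num z)).supp).sum ≤
        (E.map SuperEdge.cost).sum ∧
      (∀ z ∈ Z, compIndex num z ≠ top) ∧
      ∀ x ∈ E, (graph (B ∪ R)).Reachable s x.tgt ∨
        ∃ z ∈ Z, (graph (B ∪ R)).Reachable z x.tgt := by
  induction n generalizing E B with
  | zero =>
    obtain rfl := List.length_eq_zero_iff.1 hn
    exact ⟨∅, fun _ => 0, [], by simp, fun u v h => by simp at h, by simp, by simp, by simp,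
      by simp⟩
  | succ n ih =>
  by_cases hloop : ∃ x ∈ E, compIndex num x.src = compIndex num x.tgt
  · obtain ⟨x, hxE, hx⟩ := hloop
    have hxS := hE x hxE
    obtain ⟨pre, post, rfl⟩ := List.append_of_mem hxE
    obtain ⟨m, hpre, hmx, hpost⟩ := isJoined_append.1 hjoin
    -- The closing super edge is treated as an inner edge from now on, so the remaining super edges
    -- are still joined.
    set B' := insert s(x.src, x.tgt) B with hB'
    have hBB' : graph B ≤ graph B' := graph_mono (Finset.subset_insert _ _)
    have hx' : (graph B').Reachable x.src x.tgt := by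
      by_cases h : x.src = x.tgt
      · rw [h]
      · exact SimpleGraph.Adj.reachable ((SimpleGraph.fromEdgeSet_adj _).2
          ⟨Finset.mem_coe.2 (Finset.mem_insert_self _ _), h⟩)
    have hB'A : ∀ u v, (graph B').Reachable u v → (graph A).Reachable u v := by
      intro u v h
      refine h.of_forall_adj fun a b hab => ?_
      obtain ⟨hmem, hne⟩ := (SimpleGraph.fromEdgeSet_adj _).1 hab
      rcases Finset.mem_insert.1 (Finset.mem_coe.1 hmem) with h | h
      · rcases Sym2.eq_iff.1 h with ⟨rfl, rfl⟩ | ⟨rfl, rfl⟩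
        · exact compIndex_eq_iff.1 hx
        · exact compIndex_eq_iff.1 hx.symm
      · exact hB a b (SimpleGraph.Adj.reachable ((SimpleGraph.fromEdgeSet_adj _).2 ⟨h, hne⟩))
    have hsub : (pre ++ post).Sublist (pre ++ x :: post) :=
      (List.Sublist.refl pre).append (List.sublist_cons_self x post)
    obtain ⟨R, ℓ, Z, hR, hopt, hℓ, hZ, hZtop, hcov⟩ := ih (pre ++ post)
      (by simp at hn ⊢; omega) B' hB'A
      (isJoined_append.2 ⟨m, hpre.mono hBB',
        IsJoined.trans_left ((hmx.mono hBB').trans hx') (hpost.mono hBB')⟩)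
      (fun y hy => hE y (hsub.subset hy)) (fun E' hE' => H E' (hE'.trans hsub))
    -- The invariant for `[x]` shows that the unused budget of `x` can be discarded.
    have hcost : 0 ≤ x.cost := by
      have h := H [x] (List.singleton_sublist.2 (by simp))
      simp only [List.map_cons, List.map_nil, List.sum_cons, List.sum_nil, add_zero] at h
      exact (dominatedWidth_nonneg _ _ _).trans h
    have hlen := contractedLength_nonneg x.path
    have hZ' : (Z.map fun z => width D (num.symm (compIndex num z)).supp).sum ≤
        ((pre ++ x :: post).map SuperEdge.cost).sum := by
      simp only [List.map_append, List.map_cons, List.sum_append, List.sum_cons] at hZ ⊢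
      linarith
    have hcov' : ∀ y ∈ pre ++ x :: post, (graph (B' ∪ R)).Reachable s y.tgt ∨
        ∃ z ∈ Z, (graph (B' ∪ R)).Reachable z y.tgt := by
      intro y hy
      by_cases hyx : y = x
      · subst hyx
        have hmy : (graph (B' ∪ R)).Reachable m y.tgt :=
          ((hmx.mono hBB').trans hx').mono (graph_mono Finset.subset_union_left)
        have hle : graph B ≤ graph (B' ∪ R) :=
          hBB'.trans (graph_mono Finset.subset_union_left)
        -- The start of `x` is joined to `s` or to the target of an earlier super edge, which is
        -- covered by induction.
        rcases hpre.exists_reachable with h | ⟨w, hw, h⟩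
        · exact Or.inl ((h.mono hle).trans hmy)
        · rcases hcov w (List.mem_append_left _ hw) with h' | ⟨z, hz, h'⟩
          · exact Or.inl ((h'.trans (h.mono hle)).trans hmy)
          · exact Or.inr ⟨z, hz, (h'.trans (h.mono hle)).trans hmy⟩
      · refine hcov y ?_
        simp only [List.mem_append, List.mem_cons] at hy ⊢
        tauto
    -- `R` is a set with one length per edge: a degenerate super edge, or one whose edge is already
    -- in `R`, adds nothing and the earlier length stays.
    by_cases hold : x.src = x.tgt ∨ s(x.src, x.tgt) ∈ R
    · have hle : graph (B' ∪ R) ≤ graph (B ∪ R) := by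
        intro a b hab
        obtain ⟨hmem, hne⟩ := (SimpleGraph.fromEdgeSet_adj _).1 hab
        refine (SimpleGraph.fromEdgeSet_adj _).2 ⟨?_, hne⟩
        simp only [hB', Finset.mem_coe, Finset.mem_union, Finset.mem_insert] at hmem ⊢
        rcases hmem with (h | h) | h
        · rcases hold with h' | h'
          · rw [h'] at h
            exact absurd (Sym2.mk_isDiag_iff.1 (h ▸ Sym2.diag_isDiag x.tgt)) hne
          · exact Or.inr (h ▸ h')
        · exact Or.inl h
        · exact Or.inr h
      refine ⟨R, ℓ, Z, hR, hopt, ?_, hZ', hZtop, fun y hy => ?_⟩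
      · simp only [List.map_append, List.map_cons, List.sum_append, List.sum_cons] at hℓ ⊢
        linarith
      · exact (hcov' y hy).imp (fun h => h.mono hle) fun ⟨z, hz, h⟩ => ⟨z, hz, h.mono hle⟩
    · obtain ⟨hne, hnew⟩ := not_or.1 hold
      obtain ⟨r, hr⟩ : ∃ r : ℝ≥0, (r : ℝ) = contractedLength x.path := ⟨⟨_, hlen⟩, rfl⟩
      refine ⟨insert s(x.src, x.tgt) R,
        Function.update ℓ s(x.src, x.tgt) r, Z, ?_, ?_, ?_, hZ',
        hZtop, ?_⟩
      · intro e he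
        rcases Finset.mem_insert.1 he with rfl | he
        · refine ⟨fun h => hne (Sym2.mk_isDiag_iff.1 h), fun y hy => ?_, fun y hy z hz => ?_⟩
          · rcases Sym2.mem_iff.1 hy with rfl | rfl
            · exact hxS.src_mem
            · exact hxS.tgt_mem
          · rw [← compIndex_eq_iff (num := num)]
            rcases Sym2.mem_iff.1 hy with rfl | rfl <;> rcases Sym2.mem_iff.1 hz with rfl | rfl <;>
              first | rfl | exact hx | exact hx.symm
        · exact hR e he
      · exact hopt.insert fun u v huv S hS => hr ▸ hxS.potential_le hA hpath hx hne huv hS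
      · rw [Finset.sum_insert hnew, Function.update_self,
          Finset.sum_congr rfl fun e he => by
            rw [Function.update_of_ne (ne_of_mem_of_not_mem he hnew)]]
        simp only [List.map_append, List.map_cons, List.sum_append, List.sum_cons,
          hr] at hℓ ⊢
        linarith
      · rw [Finset.union_insert, ← Finset.insert_union]
        exact hcov'
  -- No super edge stays at its height, so the first one goes strictly down from the top, and a
  -- local minimum exists.
  · push Not at hloop
    cases E with
    | nil => simp at hn
    | cons x₀ E =>
    have hsx : compIndex num x₀.src = top := by
      rw [← hs]
      exact compIndex_eq_iff.2 (hB _ _ hjoin.1).symm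
    have hx₀ := hloop x₀ (by simp)
    obtain ⟨pre, x, y, post, heq, hdown, hup⟩ := exists_local_min (num := num) hB hjoin.2
      (by rw [ht, hsx]) (fun z hz => by rw [ht]; exact (hE z (by simp [hz])).src_le)
      (lt_of_le_of_ne (by rw [hsx]; exact (hE x₀ (by simp)).tgt_le) (Ne.symm hx₀))
      fun z hz => hloop z (by simp [hz])
    rw [heq] at hn hjoin hE H ⊢
    obtain ⟨m, hpre, hmx, hxy, hpost⟩ := isJoined_append.1 hjoin
    set r := width D (num.symm (compIndex num x.tgt)).supp with hr
    obtain ⟨R, ℓ, Z, hR, hopt, hℓ, hZ, hZtop, hcov⟩ := ih (pre ++ x.merge y r :: post)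
      (by simp at hn ⊢; omega) B hB (isJoined_append.2 ⟨m, hpre, hmx, hpost⟩)
      (fun z hz => by
        rcases List.mem_append.1 hz with h | h
        · exact hE z (by simp [h])
        · rcases List.mem_cons.1 h with rfl | h
          · exact (hE x (by simp)).merge (hE y (by simp)) (hB _ _ hxy) hdown hup r
          · exact hE z (by simp [h]))
      (fun E' hE' => dominatedWidth_merge_le hnum (hB _ _ hxy) hdown hup H hE')
    -- Merging removes `x.tgt` from the targets. Its width `r` has been paid, so it joins `Z` and
    -- covers itself.
    refine ⟨R, ℓ, x.tgt :: Z, hR, hopt, ?_, ?_, ?_, ?_⟩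
    · simp only [List.map_append, List.map_cons, List.sum_append, List.sum_cons, SuperEdge.merge,
        contractedLength_append] at hℓ ⊢
      linarith
    · simp only [List.map_append, List.map_cons, List.sum_append, List.sum_cons,
        SuperEdge.merge] at hZ ⊢
      linarith
    · intro z hz
      rcases List.mem_cons.1 hz with rfl | hz
      · exact (hdown.trans_le (hE x (by simp)).src_le).ne
      · exact hZtop z hz
    · intro z hz
      have key : ∀ w ∈ pre ++ x.merge y r :: post, (graph (B ∪ R)).Reachable s w.tgt ∨
          ∃ z ∈ x.tgt :: Z, (graph (B ∪ R)).Reachable z w.tgt := fun w hw =>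
        (hcov w hw).imp id fun ⟨z, hz, h⟩ => ⟨z, List.mem_cons_of_mem _ hz, h⟩
      simp only [List.mem_append, List.mem_cons] at hz
      rcases hz with h | rfl | rfl | h
      · exact key z (by simp [h])
      · exact Or.inr ⟨z.tgt, by simp, SimpleGraph.Reachable.refl _⟩
      · exact key (x.merge z r) (by simp)
      · exact key z (by simp [h])

end SteinerForest

/-! ### The crossing edges of a path, and the main theorem -/

namespace SteinerForest

theorem sum_toFinset_le {β : Type*} [DecidableEq β] (l : List β) {f : β → ℝ}
    (hf : ∀ b, 0 ≤ f b) : ∑ b ∈ l.toFinset, f b ≤ (l.map f).sum := by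
  induction l with
  | nil => simp
  | cons b l ih =>
    rw [List.toFinset_cons, List.map_cons, List.sum_cons]
    by_cases hb : b ∈ l.toFinset
    · rw [Finset.insert_eq_of_mem hb]
      linarith [hf b]
    · rw [Finset.sum_insert hb]
      linarith

theorem Inside.reachable {V : Type*} {A : Finset (Sym2 V)} {a b : V} (h : Inside A s(a, b)) :
    (graph A).Reachable a b :=
  h a (Sym2.mem_mk_left a b) b (Sym2.mem_mk_right a b)

theorem reachable_of_inside {V : Type*} {A B : Finset (Sym2 V)} (hB : ∀ e ∈ B, Inside A e)
    {u v : V} (h : (graph B).Reachable u v) : (graph A).Reachable u v :=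
  h.of_forall_adj fun _ _ hab => (hB _ ((SimpleGraph.fromEdgeSet_adj _).1 hab).1).reachable

theorem mem_innerEdges {V : Type*} {A F : Finset (Sym2 V)} {e : Sym2 V} :
    e ∈ innerEdges A F ↔ e ∈ F ∧ Inside A e := by
  classical
  unfold innerEdges
  rw [Finset.mem_filter]

theorem mem_crossingEdges {V : Type*} {A F : Finset (Sym2 V)} {e : Sym2 V} :
    e ∈ crossingEdges A F ↔ e ∈ F ∧ ¬ Inside A e := by
  classical
  unfold crossingEdges
  rw [Finset.mem_filter]

theorem mem_componentsMeeting {V : Type*} {F : Finset (Sym2 V)} {W : Finset V}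
    {K : (graph F).ConnectedComponent} :
    K ∈ componentsMeeting F W ↔ ∃ v ∈ W, (graph F).connectedComponentMk v = K := by
  classical
  unfold componentsMeeting
  rw [Finset.mem_image]

/-- The super edge that consists of a single edge. -/
noncomputable def edgeSuperEdge {V : Type*} [PseudoMetricSpace V] (c : ℝ) (x : V × V) :
    SuperEdge V :=
  ⟨x.1, x.2, c * dist x.1 x.2, [x]⟩

open Classical in
/-- A walk is the sequence of its crossing edges, joined by its inner edges. -/
theorem exists_crossing_list {V : Type*} [PseudoMetricSpace V] (A : Finset (Sym2 V)) (c : ℝ)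
    {H : SimpleGraph V} {s t : V} (F : H.Walk s t) :
    ∃ L : List (V × V),
      (L.map fun x => s(x.1, x.2)) = F.edges.filter (fun e => ¬ Inside A e) ∧
      ∀ G : SimpleGraph V, (∀ a b, s(a, b) ∈ F.edges → Inside A s(a, b) → G.Reachable a b) →
        IsJoined G s (L.map (edgeSuperEdge c)) t ∧
        ∀ v ∈ F.support, G.Reachable s v ∨ ∃ x ∈ L, G.Reachable x.2 v := by
  induction F with
  | nil =>
    refine ⟨[], rfl, fun G _ => ⟨SimpleGraph.Reachable.refl _, fun v hv => Or.inl ?_⟩⟩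
    rw [SimpleGraph.Walk.support_nil, List.mem_singleton] at hv
    rw [hv]
  | @cons a b _ hadj F ih =>
    obtain ⟨L, hL, hG⟩ := ih
    have hG' : ∀ G : SimpleGraph V, (∀ x y, s(x, y) ∈ (SimpleGraph.Walk.cons hadj F).edges →
        Inside A s(x, y) → G.Reachable x y) → ∀ x y, s(x, y) ∈ F.edges →
        Inside A s(x, y) → G.Reachable x y := fun G h x y hxy =>
      h x y (by rw [SimpleGraph.Walk.edges_cons]; exact List.mem_cons_of_mem _ hxy)
    by_cases hab : Inside A s(a, b)
    · refine ⟨L, ?_, fun G h => ?_⟩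
      · rw [SimpleGraph.Walk.edges_cons, List.filter_cons_of_neg (by simpa using hab), hL]
      · obtain ⟨h1, h2⟩ := hG G (hG' G h)
        have hGab := h a b (by rw [SimpleGraph.Walk.edges_cons]; exact List.mem_cons_self) hab
        refine ⟨h1.trans_left hGab, fun v hv => ?_⟩
        rw [SimpleGraph.Walk.support_cons, List.mem_cons] at hv
        rcases hv with rfl | hv
        · exact Or.inl (SimpleGraph.Reachable.refl _)
        · exact (h2 v hv).imp hGab.trans id
    · refine ⟨(a, b) :: L, ?_, fun G h => ?_⟩
      · rw [SimpleGraph.Walk.edges_cons, List.filter_cons_of_pos (by simpa using hab),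
          List.map_cons, hL]
      · obtain ⟨h1, h2⟩ := hG G (hG' G h)
        refine ⟨⟨SimpleGraph.Reachable.refl _, h1⟩, fun v hv => ?_⟩
        rw [SimpleGraph.Walk.support_cons, List.mem_cons] at hv
        rcases hv with rfl | hv
        · exact Or.inl (SimpleGraph.Reachable.refl _)
        · rcases h2 v hv with h | ⟨x, hx, h⟩
          · exact Or.inr ⟨(a, b), by simp, h⟩
          · exact Or.inr ⟨x, by simp [hx], h⟩

/-- Without connecting moves, the bound on the dominated width holds for lists of edges. -/
theorem ConnectingMoveOptimal.dominatedWidth_linkGraph_le {V : Type*} [Fintype V]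
    [PseudoMetricSpace V] {D A : Finset (Sym2 V)} (hA : Feasible D A) {p : ℕ}
    {num : (graph A).ConnectedComponent ≃ Fin p}
    (hnum : ∀ i j : Fin p, i ≤ j → width D (num.symm i).supp ≤ width D (num.symm j).supp)
    {c : ℝ} (hc : 0 ≤ c) (hconn : ConnectingMoveOptimal D A c) (L : List (V × V)) :
    dominatedWidth D num (linkGraph A (L.map (edgeSuperEdge c))) ≤
      ((L.map (edgeSuperEdge c)).map SuperEdge.cost).sum := by
  classical
  set T := (L.map fun x => s(x.1, x.2)).toFinset with hT
  have h1 : dominatedWidth D num (linkGraph A (L.map (edgeSuperEdge c))) ≤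
      dominatedWidth D num (graph (A ∪ T)) := by
    refine dominatedWidth_mono _ _ fun u v huv => reachable_of_linkGraph
      (graph_mono Finset.subset_union_left) (fun x hx => ?_) huv
    obtain ⟨y, hy, rfl⟩ := List.mem_map.1 hx
    change (graph (A ∪ T)).Reachable y.1 y.2
    by_cases hne : y.1 = y.2
    · rw [hne]
    · refine SimpleGraph.Adj.reachable ((SimpleGraph.fromEdgeSet_adj _).2 ⟨?_, hne⟩)
      refine Finset.mem_coe.2 (Finset.mem_union_right _ ?_)
      rw [hT, List.mem_toFinset]
      exact List.mem_map.2 ⟨y, hy, rfl⟩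
  have h2 := hconn.dominatedWidth_le hA hnum hc T
  have h3 : totalLength T ≤ (L.map fun x => dist x.1 x.2).sum := by
    have := sum_toFinset_le (L.map fun x => s(x.1, x.2)) (f := fun e => (len e : ℝ))
      fun _ => NNReal.coe_nonneg _
    rw [List.map_map] at this
    exact this
  have h4 : ((L.map (edgeSuperEdge c)).map SuperEdge.cost).sum =
      c * (L.map fun x => dist x.1 x.2).sum := by
    rw [List.map_map, ← List.sum_map_mul_left]
    rfl
  rw [h4]
  exact h1.trans (h2.trans (mul_le_mul_of_nonneg_left h3 hc))

end SteinerForest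

theorem mainTheorem8 {V : Type*} [Fintype V] [DecidableEq V] [PseudoMetricSpace V]
    (D A : Finset (Sym2 V)) (hA : IsSteinerForest D A)
    (p : ℕ) (num : (graph A).ConnectedComponent ≃ Fin p)
    (hnum : ∀ i j : Fin p, i ≤ j → width D (num.symm i).supp ≤ width D (num.symm j).supp)
    (c : ℝ) (hc : 1 ≤ c) (κ : RemovalRule)
    (s t : V) (F : (⊤ : SimpleGraph V).Walk s t) (hF : F.IsPath)
    (hst : compIndex num s = compIndex num t)
    (hmax : ∀ v ∈ F.support, compIndex num v ≤ compIndex num s)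
    (hne : F.edges.toFinset ≠ innerEdges A F.edges.toFinset)
    (E₀ : Finset (Sym2 V)) (hE₀ : crossingEdges A F.edges.toFinset ⊆ E₀)
    (hedge : EdgeSetSwapOptimal κ D A E₀ len)
    (hpath : PathSetSwapOptimal κ D A E₀)
    (hconn : ConnectingMoveOptimal D A c) :
    ∃ (R : Finset (Sym2 V)) (ℓ : Sym2 V → NNReal),
      -- `R` consists of edges on the endpoints of the crossing edges of the path
      (∀ e ∈ R, ¬ e.IsDiag ∧ ∀ x ∈ e, ∃ f ∈ crossingEdges A F.edges.toFinset, x ∈ f) ∧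
      innerEdges A (innerEdges A F.edges.toFinset ∪ R) = innerEdges A F.edges.toFinset ∪ R ∧
      EdgeSetSwapOptimal κ D A R ℓ ∧
      ∑ e ∈ R, (ℓ e : ℝ) ≤ totalLength (crossingEdges A F.edges.toFinset) ∧
      -- `j K` is the number of the component of `A` that contains the component `K`
      ∃ j : (graph (innerEdges A F.edges.toFinset ∪ R)).ConnectedComponent → Fin p,
        (∀ K ∈ componentsMeeting (innerEdges A F.edges.toFinset ∪ R) F.support.toFinset,
          ∀ v ∈ K.supp, compIndex num v = j K) ∧
        ∃ K₁ ∈ componentsMeeting (innerEdges A F.edges.toFinset ∪ R) F.support.toFinset,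
          j K₁ = compIndex num s ∧
          (∀ K ∈ componentsMeeting (innerEdges A F.edges.toFinset ∪ R) F.support.toFinset,
            j K = compIndex num s → K = K₁) ∧
          widthSumExcept D num (innerEdges A F.edges.toFinset ∪ R) F.support.toFinset j K₁ ≤
            c * totalLength (crossingEdges A F.edges.toFinset) := by
  have hc0 : 0 ≤ c := zero_le_one.trans hc
  obtain ⟨L, hL, hLG⟩ := exists_crossing_list A c F
  have hmemL : ∀ x ∈ L, s(x.1, x.2) ∈ F.edges ∧ ¬ Inside A s(x.1, x.2) := by
    intro x hx
    have h : s(x.1, x.2) ∈ L.map fun x => s(x.1, x.2) := List.mem_map.2 ⟨x, hx, rfl⟩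
    rw [hL, List.mem_filter] at h
    simpa using h
  have hcross : ∀ x ∈ L, s(x.1, x.2) ∈ crossingEdges A F.edges.toFinset := fun x hx =>
    mem_crossingEdges.2 ⟨List.mem_toFinset.2 (hmemL x hx).1, (hmemL x hx).2⟩
  have hlen : totalLength (crossingEdges A F.edges.toFinset) =
      (L.map fun x => dist x.1 x.2).sum := by
    have hset : crossingEdges A F.edges.toFinset = (L.map fun x => s(x.1, x.2)).toFinset := by
      ext e
      rw [hL, List.mem_toFinset, List.mem_filter, mem_crossingEdges, List.mem_toFinset]
      simp
    -- A path repeats no edge, so the sum over the list counts each crossing edge once.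
    have hnd : (L.map fun x => s(x.1, x.2)).Nodup := by
      rw [hL]
      exact hF.isTrail.edges_nodup.filter _
    rw [hset, totalLength, List.sum_toFinset _ hnd, List.map_map]
    rfl
  set B := innerEdges A F.edges.toFinset with hBdef
  have hmemB : ∀ e, e ∈ B ↔ e ∈ F.edges ∧ Inside A e := by
    intro e
    rw [hBdef, mem_innerEdges, List.mem_toFinset]
  have hBA : ∀ e ∈ B, Inside A e := fun e he => ((hmemB e).1 he).2
  obtain ⟨hjoin, hsupp⟩ := hLG (graph B) fun a b hab hin => by
    by_cases hne : a = b
    · rw [hne]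
    · exact SimpleGraph.Adj.reachable
        ((SimpleGraph.fromEdgeSet_adj _).2 ⟨(hmemB _).2 ⟨hab, hin⟩, hne⟩)
  obtain ⟨R, ℓ, Z, hR, hopt, hℓ, hZ, hZtop, hcov⟩ := exists_inner_edges
    (W := {x | ∃ f ∈ crossingEdges A F.edges.toFinset, x ∈ f}) (top := compIndex num s)
    hA hpath hnum _ (L.map (edgeSuperEdge c)) rfl B (fun u v => reachable_of_inside hBA)
    rfl hst.symm hjoin
    (fun x hx => by
      obtain ⟨y, hy, rfl⟩ := List.mem_map.1 hx
      exact
        { walk := ⟨rfl, rfl, List.isChain_singleton _⟩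
          edges := fun z hz => by
            rw [List.mem_singleton.1 hz]
            exact hE₀ (hcross y hy)
          tail := fun z hz => absurd hz List.not_mem_nil
          dropLast := fun z hz => absurd hz List.not_mem_nil
          src_mem := ⟨_, hcross y hy, Sym2.mem_mk_left _ _⟩
          tgt_mem := ⟨_, hcross y hy, Sym2.mem_mk_right _ _⟩
          src_le := hmax _ (F.fst_mem_support_of_mem_edges (hmemL y hy).1)
          tgt_le := hmax _ (F.snd_mem_support_of_mem_edges (hmemL y hy).1) })
    (fun E' hE' => by
      -- A sublist of the initial super edges is again a list of single edges that cost `c` times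
      -- their length, so the invariant holds at the start.
      obtain ⟨L', -, rfl⟩ := List.sublist_map_iff.1 hE'
      exact hconn.dominatedWidth_linkGraph_le hA.feasible hnum hc0 L')
  have hBR : ∀ e ∈ B ∪ R, Inside A e := fun e he =>
    (Finset.mem_union.1 he).elim (hBA e) fun h => (hR e h).2.2
  have hle : graph B ≤ graph (B ∪ R) := graph_mono Finset.subset_union_left
  have hindex : ∀ u v, (graph (B ∪ R)).Reachable u v → compIndex num u = compIndex num v :=
    fun u v h => compIndex_eq_iff.2 (reachable_of_inside hBR h)
  -- Inner edges connect each vertex of the path to `s` or to the target of a crossing edge, and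
  -- those targets are covered by `s` or `Z`.
  have hcover : ∀ v ∈ F.support, (graph (B ∪ R)).Reachable s v ∨
      ∃ z ∈ Z, (graph (B ∪ R)).Reachable z v := by
    intro v hv
    rcases hsupp v hv with h | ⟨x, hx, h⟩
    · exact Or.inl (h.mono hle)
    · exact (hcov _ (List.mem_map.2 ⟨x, hx, rfl⟩)).imp (fun h' => h'.trans (h.mono hle))
        fun ⟨z, hz, h'⟩ => ⟨z, hz, h'.trans (h.mono hle)⟩
  have hmeet : ∀ K ∈ componentsMeeting (B ∪ R) F.support.toFinset,
      ∃ v ∈ F.support, (graph (B ∪ R)).connectedComponentMk v = K := by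
    intro K hK
    obtain ⟨v, hv, hvK⟩ := mem_componentsMeeting.1 hK
    exact ⟨v, List.mem_toFinset.1 hv, hvK⟩
  -- The index of a component is read off an arbitrary vertex; since `B ∪ R` has inner edges only,
  -- the choice does not matter.
  refine ⟨R, ℓ, fun e he => ⟨(hR e he).1, (hR e he).2.1⟩,
    Finset.ext fun e => mem_innerEdges.trans (and_iff_left_of_imp (hBR e)), hopt,
    ?_, fun K => compIndex num K.nonempty_supp.some, ?_,
    (graph (B ∪ R)).connectedComponentMk s, ?_, ?_, ?_, ?_⟩
  · rw [hlen]
    refine hℓ.trans_eq ?_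
    rw [List.map_map]
    simp [edgeSuperEdge, contractedLength, Function.comp_def]
  · intro K _ v hv
    exact hindex _ _ (SimpleGraph.ConnectedComponent.eq.1 (hv.trans K.nonempty_supp.some_mem.symm))
  · exact mem_componentsMeeting.2 ⟨s, List.mem_toFinset.2 F.start_mem_support, rfl⟩
  · exact hindex _ _ (SimpleGraph.ConnectedComponent.eq.1
      (SimpleGraph.ConnectedComponent.nonempty_supp _).some_mem)
  -- No vertex of `Z` is at the top, so a component at the top can only be covered by `s`.
  · intro K hK hKs
    obtain ⟨v, hv, rfl⟩ := hmeet K hK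
    have hvs : compIndex num v = compIndex num s := by
      rw [← hKs]
      exact hindex _ _ (SimpleGraph.ConnectedComponent.eq.1
        (SimpleGraph.ConnectedComponent.nonempty_supp _).some_mem.symm)
    rcases hcover v hv with h | ⟨z, hz, h⟩
    · exact SimpleGraph.ConnectedComponent.eq.2 h.symm
    · exact absurd ((hindex _ _ h).trans hvs) (hZtop z hz)
  · classical
    have hpaid : ((L.map (edgeSuperEdge c)).map SuperEdge.cost).sum =
        c * totalLength (crossingEdges A F.edges.toFinset) := by
      rw [hlen, List.map_map, ← List.sum_map_mul_left]
      rfl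
    rw [← hpaid]
    refine le_trans ?_ hZ
    -- Every component other than that of `s` contains a vertex of `Z`; if several vertices of `Z`
    -- share a component, it is paid more often than necessary.
    have hsum := sum_toFinset_le (Z.map (graph (B ∪ R)).connectedComponentMk)
      (f := fun K => width D (num.symm (compIndex num K.nonempty_supp.some)).supp)
      fun _ => width_nonneg _ _
    rw [List.map_map] at hsum
    refine le_trans (Finset.sum_le_sum_of_subset_of_nonneg (fun K hK => ?_)
      fun _ _ _ => width_nonneg _ _) (hsum.trans_eq ?_)
    · obtain ⟨hne', hK⟩ := Finset.mem_erase.1 hK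
      obtain ⟨v, hv, rfl⟩ := hmeet K hK
      rcases hcover v hv with h | ⟨z, hz, h⟩
      · exact absurd (SimpleGraph.ConnectedComponent.eq.2 h.symm) hne'
      · rw [List.mem_toFinset]
        exact List.mem_map.2 ⟨z, hz, SimpleGraph.ConnectedComponent.eq.2 h⟩
    · congr 1
      refine List.map_congr_left fun z _ => ?_
      have h := hindex _ _ (SimpleGraph.ConnectedComponent.eq.1
        (((graph (B ∪ R)).connectedComponentMk z).nonempty_supp).some_mem)
      exact congrArg (fun i => width D (num.symm i).supp) h
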